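/- Let $\mathcal{A}$ be a finite non-empty index set and let $\Phi=\{\phi_a\}_{a\in\mathcal{A}}$ be an iterated function system on $\mathbb{R}^d$ (with the Euclidean norm): for every $a$ there is $r_a\in(0,1)$ with $\|\phi_a(x)-\phi_a(y)\|=r_a\|x-y\|$ for all $x,y\in\mathbb{R}^d$. No separation condition is assumed. Let $X$ be the self-similar set of $\Phi$, i.e. the unique non-empty compact set with $X=\bigcup_{a}\phi_a(X)$. For a word $\mathbf{a}=(a_1,\dots,a_n)\in\mathcal{A}^n$ put $|\mathbf{a}|=n$, $\phi_{\mathbf{a}}=\phi_{a_1}\circ\cdots\circ\phi_{a_n}$ and $X_{\mathbf{a}}=\phi_{\mathbf{a}}(X)$, and for $(a_n)\in\mathcal{A}^{\mathbb{N}}$ put $\pi((a_n))=\lim_{n\to\infty}(\phi_{a_1}\circ\cdots\circ\phi_{a_n})(0)$. Let $\dim_S(\Phi)$ be the unique $s$ with $\sum_a r_a^s=1$, let $p_a=r_a^{\dim_S(\Phi)}$ and $h_{\mathbf{p}}=-\sum_a p_a\log p_a$, and let $\mu$ be the unique Borel probability measure on $\mathbb{R}^d$ with $\mu=\sum_a p_a\cdot\phi_a\mu$,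 where $\phi_a\mu$ is the push-forward of $\mu$ under $\phi_a$. For $\Psi:\bigcup_{n\ge1}\mathcal{A}^n\to[0,\infty)$ let $$W_\Phi(\Psi)=\bigcap_{N=1}^\infty\bigcup_{n=N}^\infty\bigcup_{\mathbf{a}\in\mathcal{A}^n}\bigcup_{l=0}^{n-1}B\big(\pi(a_1\cdots a_l(a_{l+1}\cdots a_n)^\infty),\Psi(\mathbf{a})\big),$$ where $B(x,r)$ is the open ball and $(\cdot)^\infty$ denotes infinite periodic repetition. Then for every such $\Phi$ and $\Psi$ the following hold. 1. For any $s\ge 0$ (with the convention $0^0=1$), if $\sum_{n=1}^\infty\sum_{\mathbf{a}\in\mathcal{A}^n}n\,\Psi(\mathbf{a})^s<\infty$, then $\mathcal{H}^s(W_\Phi(\Psi))=0$, where $\mathcal{H}^s$ is the $s$-dimensional Hausdorff measure. 2. Assume that $h_{\mathbf{p}}<-2\log\sum_{a}p_a^2$ and that $\Psi(\mathbf{a})=\mathrm{Diam}(X_{\mathbf{a}})\,g(|\mathbf{a}|)$ for all $\mathbf{a}$, for some non-increasing $g:\mathbb{N}\to[0,\infty)$, where $\mathbb{N}=\{1,2,\dots\}$.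 If $\sum_{n=1}^\infty\sum_{\mathbf{a}\in\mathcal{A}^n}n\,(\mathrm{Diam}(X_{\mathbf{a}})g(n))^{\dim_S(\Phi)}=\infty$, then $\mu(W_\Phi(\Psi))=1$. 3. Assume that $\#\mathcal{A}\ge 2$, that $\Phi$ is equicontractive (all $r_a$ are equal), and that $\Psi(\mathbf{a})=\mathrm{Diam}(X_{\mathbf{a}})\,g(|\mathbf{a}|)$ for all $\mathbf{a}$, for some $g:\mathbb{N}\to[0,\infty)$. If $\sum_{n=1}^\infty\sum_{\mathbf{a}\in\mathcal{A}^n}n\,(\mathrm{Diam}(X_{\mathbf{a}})g(n))^{\dim_S(\Phi)}=\infty$, then $\mu(W_\Phi(\Psi))=1$. -/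

import Mathlib

open Filter Topology MeasureTheory Set
open scoped NNReal ENNReal BoundedContinuousFunction

/-- A finite family of contracting similarities of `ℝ^d` (with the Euclidean norm), indexed by the
alphabet `A`, together with their contraction ratios `ratio a ∈ (0,1)`. -/
structure IFS (A : Type*) (d : ℕ) where
  map : A → EuclideanSpace ℝ (Fin d) → EuclideanSpace ℝ (Fin d)
  ratio : A → ℝ
  ratio_pos : ∀ a, 0 < ratio a
  ratio_lt_one : ∀ a, ratio a < 1
  norm_map_sub : ∀ a x y, ‖map a x - map a y‖ = ratio a * ‖x - y‖

namespace IFS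

variable {A : Type*} {d : ℕ}

/-- `φ_{a_1} ∘ ⋯ ∘ φ_{a_n}` for a word `a = (a_1, …, a_n)` (the identity for the empty word). -/
def wordMap (Φ : IFS A d) :
    (n : ℕ) → (Fin n → A) → EuclideanSpace ℝ (Fin d) → EuclideanSpace ℝ (Fin d)
  | 0, _ => id
  | n + 1, a => Φ.map (a 0) ∘ Φ.wordMap n (fun i => a i.succ)

/-- The projection `π((a_n)_n) = lim_n (φ_{a_1} ∘ ⋯ ∘ φ_{a_n})(0)`; the limit always exists, see
`IFS.tendsto_proj`. -/
noncomputable def proj (Φ : IFS A d) (ω : ℕ → A) : EuclideanSpace ℝ (Fin d) :=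
  limUnder atTop (fun n => Φ.wordMap n (fun i : Fin n => ω i) 0)

/-- The defining property of the self-similar set. -/
def IsSelfSimilarSet (Φ : IFS A d) (X : Set (EuclideanSpace ℝ (Fin d))) : Prop :=
  X.Nonempty ∧ IsCompact X ∧ X = ⋃ a, Φ.map a '' X

/-- The defining property of the self-similar measure for the weights `p`. -/
def IsSelfSimilarMeasure [Fintype A] (Φ : IFS A d) (p : A → ℝ)
    (μ : Measure (EuclideanSpace ℝ (Fin d))) : Prop :=
  IsProbabilityMeasure μ ∧ μ = ∑ a, ENNReal.ofReal (p a) • μ.map (Φ.map a)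

section Geometry

lemma dist_map (Φ : IFS A d) (a : A) (x y : EuclideanSpace ℝ (Fin d)) :
    dist (Φ.map a x) (Φ.map a y) = Φ.ratio a * dist x y := by
  rw [dist_eq_norm, dist_eq_norm, Φ.norm_map_sub]

lemma continuous_map (Φ : IFS A d) (a : A) : Continuous (Φ.map a) := by
  have : LipschitzWith ⟨Φ.ratio a, (Φ.ratio_pos a).le⟩ (Φ.map a) :=
    LipschitzWith.of_dist_le_mul fun x y => (Φ.dist_map a x y).le
  exact this.continuous

/-- The map `φ_{ω_0} ∘ ⋯ ∘ φ_{ω_{n-1}}` along a sequence. -/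
def prefixMap (Φ : IFS A d) (ω : ℕ → A) (n : ℕ) :
    EuclideanSpace ℝ (Fin d) → EuclideanSpace ℝ (Fin d) :=
  Φ.wordMap n (fun i : Fin n => ω i)

lemma prefixMap_zero (Φ : IFS A d) (ω : ℕ → A) (x) : Φ.prefixMap ω 0 x = x := rfl

lemma prefixMap_succ (Φ : IFS A d) (ω : ℕ → A) (n : ℕ) (x) :
    Φ.prefixMap ω (n + 1) x = Φ.map (ω 0) (Φ.prefixMap (fun i => ω (i + 1)) n x) := rfl

lemma prefixMap_succ' (Φ : IFS A d) (n : ℕ) : ∀ (ω : ℕ → A) (x),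
    Φ.prefixMap ω (n + 1) x = Φ.prefixMap ω n (Φ.map (ω n) x) := by
  induction n with
  | zero => intro ω x; rfl
  | succ n ih => intro ω x; rw [prefixMap_succ, ih, prefixMap_succ]

lemma dist_prefixMap_le (Φ : IFS A d) {c : ℝ} (hc0 : 0 ≤ c) (hc : ∀ a, Φ.ratio a ≤ c) (n : ℕ) :
    ∀ (ω : ℕ → A) (x y), dist (Φ.prefixMap ω n x) (Φ.prefixMap ω n y) ≤ c ^ n * dist x y := by
  induction n with
  | zero => intro ω x y; simp [prefixMap_zero]
  | succ n ih =>
    intro ω x y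
    rw [prefixMap_succ, prefixMap_succ, dist_map, pow_succ', mul_assoc]
    exact mul_le_mul (hc _) (ih _ _ _) dist_nonneg hc0

lemma exists_ratio_le [Finite A] (Φ : IFS A d) : ∃ c : ℝ, 0 ≤ c ∧ c < 1 ∧ ∀ a, Φ.ratio a ≤ c := by
  rcases isEmpty_or_nonempty A with h | h
  · exact ⟨0, le_rfl, one_pos, fun a => h.elim a⟩
  · obtain ⟨a, ha⟩ := Finite.exists_max Φ.ratio
    exact ⟨Φ.ratio a, (Φ.ratio_pos a).le, Φ.ratio_lt_one a, ha⟩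

variable [Finite A]

/-- The approximations to `π` converge, at a rate that is uniform over all sequences. -/
lemma exists_proj_bound (Φ : IFS A d) : ∃ c C : ℝ, 0 ≤ c ∧ c < 1 ∧ (∀ a, Φ.ratio a ≤ c) ∧
    ∀ ω : ℕ → A, Tendsto (fun n => Φ.prefixMap ω n 0) atTop (𝓝 (Φ.proj ω)) ∧
      ∀ n, dist (Φ.prefixMap ω n 0) (Φ.proj ω) ≤ C * c ^ n := by
  obtain ⟨c, hc0, hc1, hc⟩ := Φ.exists_ratio_le
  obtain ⟨M, hM⟩ := (Set.finite_range fun a => dist 0 (Φ.map a 0)).bddAbove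
  have hM' : ∀ a, dist 0 (Φ.map a 0) ≤ M := fun a => hM ⟨a, rfl⟩
  refine ⟨c, M / (1 - c), hc0, hc1, hc, fun ω => ?_⟩
  have hstep : ∀ n, dist (Φ.prefixMap ω n 0) (Φ.prefixMap ω (n + 1) 0) ≤ M * c ^ n := by
    intro n
    rw [prefixMap_succ', mul_comm]
    exact (Φ.dist_prefixMap_le hc0 hc n ω _ _).trans
      (mul_le_mul_of_nonneg_left (hM' _) (pow_nonneg hc0 n))
  have hlim : Tendsto (fun n => Φ.prefixMap ω n 0) atTop (𝓝 (Φ.proj ω)) :=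
    CauchySeq.tendsto_limUnder (cauchySeq_of_le_geometric c M hc1 hstep)
  refine ⟨hlim, fun n => ?_⟩
  have := dist_le_of_le_geometric_of_tendsto c M hc1 hstep hlim n
  rwa [div_mul_eq_mul_div]

lemma tendsto_proj (Φ : IFS A d) (ω : ℕ → A) :
    Tendsto (fun n => Φ.wordMap n (fun i : Fin n => ω i) 0) atTop (𝓝 (Φ.proj ω)) := by
  obtain ⟨c, C, -, -, -, h⟩ := Φ.exists_proj_bound
  exact (h ω).1

/-- In the definition of `π` the base points may vary in a bounded set. -/
lemma tendsto_prefixMap (Φ : IFS A d) (ω : ℕ → A) (x : ℕ → EuclideanSpace ℝ (Fin d)) {R : ℝ}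
    (hx : ∀ n, dist (x n) 0 ≤ R) :
    Tendsto (fun n => Φ.prefixMap ω n (x n)) atTop (𝓝 (Φ.proj ω)) := by
  obtain ⟨c, C, hc0, hc1, hc, h⟩ := Φ.exists_proj_bound
  refine tendsto_of_tendsto_of_dist (h ω).1 ?_
  have h0 : Tendsto (fun n => c ^ n * R) atTop (𝓝 0) := by
    simpa using (tendsto_pow_atTop_nhds_zero_of_lt_one hc0 hc1).mul_const R
  refine squeeze_zero (fun _ => dist_nonneg) (fun n => ?_) h0
  rw [dist_comm]
  exact (Φ.dist_prefixMap_le hc0 hc n ω _ _).trans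
    (mul_le_mul_of_nonneg_left (hx n) (pow_nonneg hc0 n))

lemma proj_eq_map (Φ : IFS A d) (ω : ℕ → A) :
    Φ.proj ω = Φ.map (ω 0) (Φ.proj fun i => ω (i + 1)) := by
  have h1 : Tendsto (fun n => Φ.prefixMap ω (n + 1) 0) atTop (𝓝 (Φ.proj ω)) :=
    (tendsto_add_atTop_iff_nat 1).2 (Φ.tendsto_proj ω)
  have h2 := ((Φ.continuous_map (ω 0)).tendsto _).comp (Φ.tendsto_proj fun i => ω (i + 1))
  exact tendsto_nhds_unique h1 h2

/-- Prepending a letter to a sequence. -/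
def cons (a : A) (ω : ℕ → A) : ℕ → A
  | 0 => a
  | n + 1 => ω n

lemma proj_cons (Φ : IFS A d) (a : A) (ω : ℕ → A) :
    Φ.proj (cons a ω) = Φ.map a (Φ.proj ω) := Φ.proj_eq_map _

lemma continuous_proj [TopologicalSpace A] [DiscreteTopology A] (Φ : IFS A d) :
    Continuous Φ.proj := by
  obtain ⟨c, C, hc0, hc1, -, h⟩ := Φ.exists_proj_bound
  have hunif : TendstoUniformly (fun n ω => Φ.prefixMap ω n 0) Φ.proj atTop := by
    rw [Metric.tendstoUniformly_iff]
    intro ε hε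
    have h0 : Tendsto (fun n => C * c ^ n) atTop (𝓝 0) := by
      simpa using (tendsto_pow_atTop_nhds_zero_of_lt_one hc0 hc1).const_mul C
    filter_upwards [h0.eventually (gt_mem_nhds hε)] with n hn ω
    rw [dist_comm]
    exact ((h ω).2 n).trans_lt hn
  refine hunif.continuous (Frequently.of_forall fun n => ?_)
  induction n with
  | zero => exact continuous_const
  | succ n ih =>
    have hF : Continuous fun q : A × EuclideanSpace ℝ (Fin d) => Φ.map q.1 q.2 :=
      continuous_prod_of_discrete_left.2 fun a => Φ.continuous_map a
    have hs : Continuous fun (ω : ℕ → A) (i : ℕ) => ω (i + 1) :=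
      continuous_pi fun i => continuous_apply (i + 1)
    have hi : Continuous fun ω : ℕ → A => Φ.prefixMap (fun i => ω (i + 1)) n 0 := ih.comp hs
    have h0 : Continuous fun ω : ℕ → A => ω 0 := continuous_apply 0
    exact hF.comp (h0.prodMk hi)

lemma isSelfSimilarSet_range_proj [Nonempty A] (Φ : IFS A d) :
    Φ.IsSelfSimilarSet (range Φ.proj) := by
  refine ⟨range_nonempty _, ?_, ?_⟩
  · let _ : TopologicalSpace A := ⊥
    have : DiscreteTopology A := ⟨rfl⟩
    exact isCompact_range Φ.continuous_proj
  · ext x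
    simp only [mem_range, mem_iUnion, mem_image]
    constructor
    · rintro ⟨ω, rfl⟩
      exact ⟨ω 0, _, ⟨_, rfl⟩, (Φ.proj_eq_map ω).symm⟩
    · rintro ⟨a, _, ⟨ω, rfl⟩, rfl⟩
      exact ⟨cons a ω, Φ.proj_cons a ω⟩

lemma IsSelfSimilarSet.eq_range_proj {Φ : IFS A d} {X : Set (EuclideanSpace ℝ (Fin d))}
    (hX : Φ.IsSelfSimilarSet X) : X = range Φ.proj := by
  obtain ⟨⟨x0, hx0⟩, hcomp, hinv⟩ := hX
  have hbound : ∃ R, ∀ x ∈ X, dist x 0 ≤ R := by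
    obtain ⟨R, hR⟩ := hcomp.isBounded.subset_closedBall 0
    exact ⟨R, fun x hx => hR hx⟩
  obtain ⟨R, hR⟩ := hbound
  have hmem : ∀ n (ω : ℕ → A), ∀ x ∈ X, Φ.prefixMap ω n x ∈ X := by
    intro n
    induction n with
    | zero => intro ω x hx; exact hx
    | succ n ih =>
      intro ω x hx
      rw [prefixMap_succ, hinv]
      exact mem_iUnion.2 ⟨_, mem_image_of_mem _ (ih _ x hx)⟩
  apply Subset.antisymm
  · intro x hx
    have hstep : ∀ y : X, ∃ (a : A) (z : X), Φ.map a z = y := by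
      rintro ⟨y, hy⟩
      have hy' := hy
      rw [hinv] at hy'
      obtain ⟨a, z, hz, hzy⟩ := mem_iUnion.1 hy'
      exact ⟨a, ⟨z, hz⟩, hzy⟩
    choose α ζ hαζ using hstep
    let y : ℕ → X := fun n => ζ^[n] ⟨x, hx⟩
    let ω : ℕ → A := fun n => α (y n)
    have hy : ∀ n, Φ.map (ω n) (y (n + 1)) = y n := by
      intro n
      have : y (n + 1) = ζ (y n) := Function.iterate_succ_apply' _ _ _
      rw [this]
      exact hαζ (y n)
    have hx' : ∀ n, Φ.prefixMap ω n (y n) = x := by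
      intro n
      induction n with
      | zero => rfl
      | succ n ih => rw [prefixMap_succ', hy, ih]
    refine ⟨ω, ?_⟩
    have h1 := Φ.tendsto_prefixMap ω (fun n => (y n : EuclideanSpace ℝ (Fin d)))
      (fun n => hR _ (y n).2)
    simp only [hx'] at h1
    exact tendsto_nhds_unique h1 tendsto_const_nhds
  · rintro _ ⟨ω, rfl⟩
    exact hcomp.isClosed.mem_of_tendsto (Φ.tendsto_prefixMap ω (fun _ => x0) fun _ => hR _ hx0)
      (Eventually.of_forall fun n => hmem n ω x0 hx0)

/-- Existence and uniqueness of the self-similar set. -/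
theorem existsUnique_selfSimilarSet [Nonempty A] (Φ : IFS A d) :
    ∃! X : Set (EuclideanSpace ℝ (Fin d)), Φ.IsSelfSimilarSet X :=
  ⟨range Φ.proj, Φ.isSelfSimilarSet_range_proj, fun _ hX => hX.eq_range_proj⟩

/-- The self-similar set `X` of `Φ`: the unique non-empty compact set with `X = ⋃ φ_a(X)`. -/
noncomputable def selfSimilarSet [Nonempty A] (Φ : IFS A d) : Set (EuclideanSpace ℝ (Fin d)) :=
  Φ.existsUnique_selfSimilarSet.choose

theorem selfSimilarSet_spec [Nonempty A] (Φ : IFS A d) : Φ.IsSelfSimilarSet Φ.selfSimilarSet :=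
  Φ.existsUnique_selfSimilarSet.choose_spec.1

theorem selfSimilarSet_eq_range_proj [Nonempty A] (Φ : IFS A d) :
    Φ.selfSimilarSet = range Φ.proj :=
  Φ.selfSimilarSet_spec.eq_range_proj

/-- `X_a = φ_a(X)` for a finite word `a`. -/
noncomputable def cylinderSet [Nonempty A] (Φ : IFS A d) {n : ℕ} (a : Fin n → A) :
    Set (EuclideanSpace ℝ (Fin d)) :=
  Φ.wordMap n a '' Φ.selfSimilarSet

end Geometry

section Dimension

variable [Fintype A] [Nonempty A]

/-- Existence and uniqueness of the similarity dimension. -/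
theorem existsUnique_dimS (Φ : IFS A d) : ∃! s : ℝ, ∑ a, Φ.ratio a ^ s = 1 := by
  have hanti : StrictAnti fun s : ℝ => ∑ a, Φ.ratio a ^ s := by
    intro s t hst
    exact Finset.sum_lt_sum_of_nonempty Finset.univ_nonempty fun a _ =>
      Real.rpow_lt_rpow_of_exponent_gt (Φ.ratio_pos a) (Φ.ratio_lt_one a) hst
  have hcont : Continuous fun s : ℝ => ∑ a, Φ.ratio a ^ s :=
    continuous_finsetSum _ fun a _ => Real.continuous_const_rpow (Φ.ratio_pos a).ne'
  have hlim : Tendsto (fun s : ℝ => ∑ a, Φ.ratio a ^ s) atTop (𝓝 0) := by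
    have := tendsto_finsetSum (Finset.univ : Finset A) fun a _ =>
      tendsto_rpow_atTop_of_base_lt_one (Φ.ratio a)
        (by linarith [Φ.ratio_pos a]) (Φ.ratio_lt_one a)
    simpa using this
  obtain ⟨S, hS0, hS1⟩ := ((eventually_ge_atTop (0 : ℝ)).and
    (hlim.eventually (gt_mem_nhds one_pos))).exists
  have h0 : (1 : ℝ) ≤ ∑ a, Φ.ratio a ^ (0 : ℝ) := by
    simp only [Real.rpow_zero, Finset.sum_const, Finset.card_univ, nsmul_eq_mul, mul_one]
    exact_mod_cast Fintype.card_pos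
  obtain ⟨s, -, hs⟩ := intermediate_value_Icc' hS0 hcont.continuousOn ⟨hS1.le, h0⟩
  exact ⟨s, hs, fun t ht => hanti.injective (ht.trans hs.symm)⟩

/-- The similarity dimension: the unique `s` with `∑ r_a ^ s = 1`. -/
noncomputable def dimS (Φ : IFS A d) : ℝ := Φ.existsUnique_dimS.choose

theorem sum_ratio_rpow_dimS (Φ : IFS A d) : ∑ a, Φ.ratio a ^ Φ.dimS = 1 :=
  Φ.existsUnique_dimS.choose_spec.1

/-- The canonical probability vector `p_a = r_a ^ dim_S(Φ)`. -/
noncomputable def prob (Φ : IFS A d) (a : A) : ℝ := Φ.ratio a ^ Φ.dimS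

theorem prob_nonneg (Φ : IFS A d) (a : A) : 0 ≤ Φ.prob a :=
  Real.rpow_nonneg (Φ.ratio_pos a).le _

theorem sum_prob (Φ : IFS A d) : ∑ a, Φ.prob a = 1 := Φ.sum_ratio_rpow_dimS

end Dimension

section Measure

lemma measurable_cons [MeasurableSpace A] (a : A) : Measurable (cons a : (ℕ → A) → ℕ → A) := by
  refine measurable_pi_lambda _ fun i => ?_
  cases i with
  | zero => exact measurable_const
  | succ n => exact measurable_pi_apply n

variable [Fintype A]

/-- The distribution on the alphabet that gives the letter `a` the mass `p a`. -/
noncomputable def letterMeasure [MeasurableSpace A] (p : A → ℝ) : Measure A :=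
  ∑ a, ENNReal.ofReal (p a) • Measure.dirac a

lemma isProbabilityMeasure_letterMeasure [MeasurableSpace A] {p : A → ℝ} (hp : ∀ a, 0 ≤ p a)
    (hp1 : ∑ a, p a = 1) : IsProbabilityMeasure (letterMeasure p) := by
  constructor
  simp only [letterMeasure, Measure.coe_finsetSum, Finset.sum_apply, Measure.smul_apply,
    measure_univ, smul_eq_mul, mul_one]
  rw [← ENNReal.ofReal_sum_of_nonneg fun a _ => hp a, hp1, ENNReal.ofReal_one]

variable [MeasurableSpace A]

/-- The Bernoulli measure is self-similar under prepending letters. -/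
lemma bernoulli_eq_sum {p : A → ℝ} [IsProbabilityMeasure (letterMeasure p)] :
    Measure.infinitePi (fun _ : ℕ => letterMeasure p) =
      ∑ a, ENNReal.ofReal (p a) •
        (Measure.infinitePi (fun _ : ℕ => letterMeasure p)).map (cons a) := by
  classical
  symm
  refine Measure.eq_infinitePi _ fun s t ht => ?_
  obtain ⟨n, hn⟩ : ∃ n, s ⊆ Finset.range (n + 1) := by
    obtain ⟨n, hn⟩ := s.exists_nat_subset_range
    exact ⟨n, hn.trans (Finset.range_mono n.le_succ)⟩
  let t' : ℕ → Set A := fun i => if i ∈ s then t i else univ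
  have ht' : ∀ i, MeasurableSet (t' i) := fun i => by
    by_cases h : i ∈ s <;> simp [t', h, ht i]
  have hpi : Set.pi (s : Set ℕ) t = Set.pi (Finset.range (n + 1) : Set ℕ) t' := by
    ext ω
    simp only [Set.mem_pi, Finset.mem_coe]
    constructor
    · intro h i _
      by_cases hi : i ∈ s
      · simpa [t', hi] using h i hi
      · simp [t', hi]
    · intro h i hi
      simpa [t', hi] using h i (hn hi)
  have hprod : ∏ i ∈ s, letterMeasure p (t i) =
      ∏ i ∈ Finset.range (n + 1), letterMeasure p (t' i) := by
    rw [← Finset.prod_subset hn (f := fun i => letterMeasure p (t' i))]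
    · exact Finset.prod_congr rfl fun i hi => by simp [t', hi]
    · intro i _ hi
      simp [t', hi]
  have hmeas : MeasurableSet (Set.pi (Finset.range (n + 1) : Set ℕ) t') :=
    MeasurableSet.pi (Finset.countable_toSet _) fun i _ => ht' i
  have hcons : ∀ a, (Measure.infinitePi (fun _ : ℕ => letterMeasure p)).map (cons a)
      (Set.pi (Finset.range (n + 1) : Set ℕ) t') =
      (t' 0).indicator 1 a * ∏ i ∈ Finset.range n, letterMeasure p (t' (i + 1)) := by
    intro a
    rw [Measure.map_apply (measurable_cons a) hmeas]
    by_cases ha : a ∈ t' 0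
    · have : cons a ⁻¹' (Set.pi (Finset.range (n + 1) : Set ℕ) t') =
          Set.pi (Finset.range n : Set ℕ) (fun i => t' (i + 1)) := by
        ext ω
        simp only [mem_preimage, Set.mem_pi, Finset.mem_coe, Finset.mem_range]
        constructor
        · intro h i hi
          exact h (i + 1) (by omega)
        · intro h i hi
          cases i with
          | zero => exact ha
          | succ i => exact h i (by omega)
      rw [this, Measure.infinitePi_pi _ fun i _ => ht' (i + 1)]
      simp [ha]
    · have : cons a ⁻¹' (Set.pi (Finset.range (n + 1) : Set ℕ) t') = ∅ := by
        ext ω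
        simp only [mem_preimage, Set.mem_pi, Finset.mem_coe, Finset.mem_range, mem_empty_iff_false,
          iff_false]
        intro h
        exact ha (h 0 (by omega))
      rw [this]
      simp [ha]
  rw [hpi, hprod, Finset.prod_range_succ', Measure.coe_finsetSum, Finset.sum_apply]
  simp only [Measure.smul_apply, hcons, smul_eq_mul]
  simp only [← mul_assoc]
  rw [← Finset.sum_mul, mul_comm]
  congr 1
  simp only [letterMeasure, Measure.coe_finsetSum, Finset.sum_apply, Measure.smul_apply,
    smul_eq_mul, Measure.dirac_apply' _ (ht' 0)]

variable [MeasurableSingletonClass A]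

lemma measurable_prefixMap (Φ : IFS A d) (n : ℕ) :
    Measurable fun q : (ℕ → A) × EuclideanSpace ℝ (Fin d) => Φ.prefixMap q.1 n q.2 := by
  induction n with
  | zero => exact measurable_snd
  | succ n ih =>
    have hF : Measurable fun q : EuclideanSpace ℝ (Fin d) × A => Φ.map q.2 q.1 :=
      measurable_from_prod_countable_left fun a => (Φ.continuous_map a).measurable
    have hs : Measurable fun q : (ℕ → A) × EuclideanSpace ℝ (Fin d) =>
        ((fun i => q.1 (i + 1) : ℕ → A), q.2) :=
      (measurable_pi_lambda _ fun i => (measurable_pi_apply (i + 1)).comp measurable_fst).prodMk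
        measurable_snd
    exact hF.comp ((ih.comp hs).prodMk ((measurable_pi_apply 0).comp measurable_fst))

lemma measurable_proj (Φ : IFS A d) : Measurable Φ.proj := by
  refine measurable_of_tendsto_metrizable
    (f := fun n (ω : ℕ → A) => Φ.prefixMap ω n 0) (fun n => ?_)
    (tendsto_pi_nhds.2 fun ω => Φ.tendsto_proj ω)
  exact (Φ.measurable_prefixMap n).comp (measurable_id.prodMk measurable_const)

lemma isSelfSimilarMeasure_map_proj (Φ : IFS A d) {p : A → ℝ}
    [IsProbabilityMeasure (letterMeasure p)] :
    Φ.IsSelfSimilarMeasure p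
      ((Measure.infinitePi (fun _ : ℕ => letterMeasure p)).map Φ.proj) := by
  refine ⟨Measure.isProbabilityMeasure_map Φ.measurable_proj.aemeasurable, ?_⟩
  ext S hS
  conv_lhs => rw [bernoulli_eq_sum]
  rw [Measure.map_apply Φ.measurable_proj hS]
  simp only [Measure.coe_finsetSum, Finset.sum_apply, Measure.smul_apply]
  refine Finset.sum_congr rfl fun a _ => ?_
  have hm := (Φ.continuous_map a).measurable
  rw [Measure.map_apply (measurable_cons a) (Φ.measurable_proj hS), Measure.map_apply hm hS,
    Measure.map_apply Φ.measurable_proj (hm hS)]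
  congr 2
  ext ω
  simp only [mem_preimage, proj_cons]

lemma lintegral_prefixMap {Φ : IFS A d} {p : A → ℝ} [IsProbabilityMeasure (letterMeasure p)]
    {μ : Measure (EuclideanSpace ℝ (Fin d))} (hμ : Φ.IsSelfSimilarMeasure p μ) (n : ℕ) :
    ∀ g : EuclideanSpace ℝ (Fin d) → ℝ≥0∞, Measurable g →
      ∫⁻ ω, ∫⁻ z, g (Φ.prefixMap ω n z) ∂μ
        ∂(Measure.infinitePi (fun _ : ℕ => letterMeasure p)) = ∫⁻ z, g z ∂μ := by
  have := hμ.1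
  induction n with
  | zero => intro g _; simp [prefixMap_zero]
  | succ n ih =>
    intro g hg
    have hinner : Measurable fun ω : ℕ → A => ∫⁻ z, g (Φ.prefixMap ω (n + 1) z) ∂μ :=
      (hg.comp (Φ.measurable_prefixMap (n + 1))).lintegral_prod_right'
    conv_lhs => rw [bernoulli_eq_sum]
    conv_rhs => rw [hμ.2]
    rw [lintegral_finsetSum_measure, lintegral_finsetSum_measure]
    refine Finset.sum_congr rfl fun a _ => ?_
    rw [lintegral_smul_measure, lintegral_smul_measure, lintegral_map hinner (measurable_cons a),
      lintegral_map hg (Φ.continuous_map a).measurable]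
    congr 1
    exact ih (fun z => g (Φ.map a z)) (hg.comp (Φ.continuous_map a).measurable)

lemma IsSelfSimilarMeasure.eq_map_proj {Φ : IFS A d} {p : A → ℝ}
    [IsProbabilityMeasure (letterMeasure p)] {μ : Measure (EuclideanSpace ℝ (Fin d))}
    (hμ : Φ.IsSelfSimilarMeasure p μ) :
    μ = (Measure.infinitePi (fun _ : ℕ => letterMeasure p)).map Φ.proj := by
  have := hμ.1
  set m := Measure.infinitePi (fun _ : ℕ => letterMeasure p) with hm
  refine ext_of_forall_lintegral_eq_of_IsFiniteMeasure fun f => ?_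
  have hf : Measurable fun x => (f x : ℝ≥0∞) := f.continuous.measurable.coe_nnreal_ennreal
  rw [lintegral_map hf Φ.measurable_proj]
  have hconv : Tendsto (fun n => ∫⁻ q, (f (Φ.prefixMap q.1 n q.2) : ℝ≥0∞) ∂(m.prod μ)) atTop
      (𝓝 (∫⁻ q, (f (Φ.proj q.1) : ℝ≥0∞) ∂(m.prod μ))) := by
    refine tendsto_lintegral_of_dominated_convergence (fun _ => (nndist f 0 : ℝ≥0∞))
      (fun n => hf.comp (Φ.measurable_prefixMap n)) (fun n => Eventually.of_forall fun q => ?_)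
      (by simp [-nndist_zero_right]) (Eventually.of_forall fun q => ?_)
    · have := f.nndist_coe_le_nndist (g := 0) (Φ.prefixMap q.1 n q.2)
      rw [BoundedContinuousFunction.coe_zero, Pi.zero_apply, NNReal.nndist_zero_eq_val'] at this
      exact ENNReal.coe_le_coe.2 this
    · exact (ENNReal.continuous_coe.comp f.continuous).continuousAt.tendsto.comp
        (Φ.tendsto_prefixMap q.1 (fun _ => q.2) fun _ => le_rfl)
  have hconst : ∀ n, ∫⁻ q, (f (Φ.prefixMap q.1 n q.2) : ℝ≥0∞) ∂(m.prod μ) =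
      ∫⁻ z, (f z : ℝ≥0∞) ∂μ := by
    intro n
    have hfn : Measurable fun q : (ℕ → A) × EuclideanSpace ℝ (Fin d) =>
        (f (Φ.prefixMap q.1 n q.2) : ℝ≥0∞) := hf.comp (Φ.measurable_prefixMap n)
    rw [lintegral_prod _ hfn.aemeasurable]
    exact lintegral_prefixMap hμ n _ hf
  simp only [hconst] at hconv
  have hlim : ∫⁻ q, (f (Φ.proj q.1) : ℝ≥0∞) ∂(m.prod μ) = ∫⁻ ω, (f (Φ.proj ω) : ℝ≥0∞) ∂m := by
    have hfp : Measurable fun q : (ℕ → A) × EuclideanSpace ℝ (Fin d) =>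
        (f (Φ.proj q.1) : ℝ≥0∞) := hf.comp (Φ.measurable_proj.comp measurable_fst)
    rw [lintegral_prod _ hfp.aemeasurable]
    simp
  rw [← hlim]
  exact tendsto_nhds_unique tendsto_const_nhds hconv

end Measure

section SelfSimilarMeasure

variable [Fintype A]

/-- Existence and uniqueness of the self-similar measure for a probability vector. -/
theorem existsUnique_isSelfSimilarMeasure (Φ : IFS A d) {p : A → ℝ} (hp : ∀ a, 0 ≤ p a)
    (hp1 : ∑ a, p a = 1) :
    ∃! μ : Measure (EuclideanSpace ℝ (Fin d)), Φ.IsSelfSimilarMeasure p μ := by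
  let _ : MeasurableSpace A := ⊤
  have := isProbabilityMeasure_letterMeasure hp hp1
  exact ⟨_, Φ.isSelfSimilarMeasure_map_proj, fun _ hμ => hμ.eq_map_proj⟩

variable [Nonempty A]

/-- The self-similar measure `μ_Φ`: the unique Borel probability measure with
`μ = ∑ p_a • φ_a μ`, where `p_a = r_a ^ dim_S(Φ)`. -/
noncomputable def selfSimilarMeasure (Φ : IFS A d) : Measure (EuclideanSpace ℝ (Fin d)) :=
  (Φ.existsUnique_isSelfSimilarMeasure Φ.prob_nonneg Φ.sum_prob).choose

theorem selfSimilarMeasure_spec (Φ : IFS A d) :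
    Φ.IsSelfSimilarMeasure Φ.prob Φ.selfSimilarMeasure :=
  (Φ.existsUnique_isSelfSimilarMeasure Φ.prob_nonneg Φ.sum_prob).choose_spec.1

end SelfSimilarMeasure

/-- The eventually periodic sequence `a_1 ⋯ a_l (a_{l+1} ⋯ a_n)^∞`, for a word `a` of length `n`
and `0 ≤ l ≤ n - 1` (in the code letters are numbered from `0`). -/
def eventuallyPeriodic {n : ℕ} (a : Fin n → A) (l : Fin n) (i : ℕ) : A :=
  if h : i < l then a ⟨i, h.trans l.isLt⟩
  else a ⟨l + (i - l) % (n - l), by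
    have h1 := l.isLt
    have h2 : (i - l) % (n - l) < n - l := Nat.mod_lt _ (by omega)
    omega⟩

/-- The limsup set `W_Φ(Ψ) = ⋂_{N ≥ 1} ⋃_{n ≥ N} ⋃_{a ∈ A^n} ⋃_{0 ≤ l ≤ n - 1}
B(π(a_1 ⋯ a_l (a_{l+1} ⋯ a_n)^∞), Ψ(a))`, with open balls. Only words of positive length enter. -/
noncomputable def limsupSet (Φ : IFS A d) (Ψ : (n : ℕ) → (Fin n → A) → ℝ≥0) :
    Set (EuclideanSpace ℝ (Fin d)) :=
  ⋂ N ≥ 1, ⋃ n ≥ N, ⋃ a : Fin n → A, ⋃ l : Fin n,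
    Metric.ball (Φ.proj (eventuallyPeriodic a l)) (Ψ n a)

end IFS

/-- The entropy `h_p = -∑ p_a log p_a`. -/
noncomputable def entropy {A : Type*} [Fintype A] (p : A → ℝ) : ℝ :=
  -∑ a, p a * Real.log (p a)

/-!
For `ω` distributed according to the Bernoulli measure with weights `p_a = r_a ^ dim_S(Φ)`, the point
`π(ω)` has distribution `μ`. If the letters of `ω` from position `n` on repeat the letters from some
earlier position `l` on, until the repeated word has weight less than `g(n) ^ dim_S(Φ)`, then `ω`
agrees that far with `ω_0 ⋯ ω_{l-1} (ω_l ⋯ ω_{n-1})^∞`, so `π(ω)` lies in the corresponding ball of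
`W_Φ(Ψ)` (`proj_mem_ball_of_mem_recurSet`). The words of length `n` have total weight `1`, so the
divergence assumption says that `∑ n * g(n) ^ dim_S(Φ)` diverges (`sum_words_eq`). It thus suffices
to prove a Borel–Cantelli lemma for these recurrences: if `∑ n δ_n = ∞`, then almost surely, for
infinitely many `n`, the word at position `n` cut at weight `δ_n` occurs at an earlier position
(`ae_frequently_mem_recurSet`).

Given the first `n` letters, the word that a recurrence to `l < n` prescribes is determined, even if
the two occurrences overlap, so a recurrence has probability comparable to `δ_n`. For the second
moment one needs that recurrences `(n, l)` and `(n + j, l')` are quasi-independent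
(`bernoulli_recurSet_inter_le`). If the first one is over before time `n + j`, one conditions on the
first `n + j` letters. Otherwise let `q` be the weight of the first `j` letters at `l`. The words at
`l + j` and `l'` have to agree up to weight `δ_n / q`, and then the word at `n` is prescribed up to
weight `q * δ_{n+j}`; the factors `q` cancel and the product `δ_n * δ_{n+j}` remains. If
`l' = l + j`, the first condition is void and the bound is the expectation of `q * δ_{n+j}`, which
decays exponentially in `j`.

This uses that the second recurrence reaches further than the first one. Here lies the only
influence of the shape of `g`, and it is removed by discarding every time `n` for which
`δ_n < ρ ^ (n' - n) * δ_{n'}` for a later time `n'`, where `ρ < 1` is the largest weight of a letter.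
The discarded terms are bounded by geometric series, so the remaining series still diverges
(`exists_undominated_set`). The Chung–Erdős inequality now gives infinitely many recurrences with
positive probability, and Kolmogorov's zero-one law makes the probability `1`, since recurrences
are only looked for at positions `l ≥ n / 4`. Both divergence statements are thus instances of
`selfSimilarMeasure_limsupSet_eq_one`, the entropy bound entering through
`two_le_card_of_entropy_lt`.

The convergence statement is the usual covering argument, each word of length `n` contributing `n`
balls.
-/

namespace SymbolicRecurrence

/-! ### Sequences and recurrences -/

variable {A : Type*}

/-- The `n`-fold left shift on sequences. -/
def shift (n : ℕ) (ω : ℕ → A) : ℕ → A := fun i => ω (n + i)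

/-- The sequence that starts with the first `N` letters of `ω` and continues with `η`. -/
def glue (N : ℕ) (ω η : ℕ → A) : ℕ → A := fun i => if i < N then ω i else η (i - N)

/-- The periodic sequence whose period is the stretch `ω_l ⋯ ω_{n-1}` of `ω`. -/
def periodize (l n : ℕ) (ω : ℕ → A) : ℕ → A := fun i => ω (l + i % (n - l))

/-- The weight `p_{x_0} ⋯ p_{x_{k-1}}` of the prefix of length `k` of `x`. -/
def weight (p : A → ℝ) (x : ℕ → A) (k : ℕ) : ℝ := ∏ i ∈ Finset.range k, p (x i)

/-- The sequences `x` and `y` have a common prefix of weight at most `δ`. -/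
def Agree (p : A → ℝ) (δ : ℝ) (x y : ℕ → A) : Prop :=
  ∃ k, weight p x k ≤ δ ∧ ∀ i < k, x i = y i

/-- The event that the prefix of `σⁿ ω` cut at weight `δ` also occurs at position `l` of `ω`. -/
def recurSet (p : A → ℝ) (δ : ℝ) (n l : ℕ) : Set (ℕ → A) :=
  {ω | Agree p δ (shift l ω) (shift n ω)}

/-! ### Weights and common prefixes -/

lemma weight_congr {p : A → ℝ} {x y : ℕ → A} {k : ℕ} (h : ∀ i < k, x i = y i) :
    weight p x k = weight p y k :=
  Finset.prod_congr rfl fun i hi => by rw [h i (Finset.mem_range.1 hi)]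

lemma weight_add (p : A → ℝ) (x : ℕ → A) (j k : ℕ) :
    weight p x (j + k) = weight p x j * weight p (shift j x) k :=
  Finset.prod_range_add _ _ _

lemma weight_succ (p : A → ℝ) (x : ℕ → A) (k : ℕ) :
    weight p x (k + 1) = weight p x k * p (x k) := Finset.prod_range_succ _ _

lemma shift_shift (m n : ℕ) (ω : ℕ → A) : shift m (shift n ω) = shift (n + m) ω := by
  funext i
  simp [shift, add_assoc]

lemma shift_glue (N : ℕ) (ω η : ℕ → A) : shift N (glue N ω η) = η := by
  funext i
  simp [shift, glue]

lemma glue_apply_of_lt {N i : ℕ} (h : i < N) (ω η : ℕ → A) : glue N ω η i = ω i := by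
  simp [glue, h]

/-- A function of the first `N` letters does not see the letters glued on behind them. -/
lemma DependsOn.glue_eq {β : Type*} {f : (ℕ → A) → β} {N : ℕ} (hf : DependsOn f (Iio N))
    (ω η : ℕ → A) : f (glue N ω η) = f ω :=
  hf fun _ hi => glue_apply_of_lt hi ω η

lemma dependsOn_weight_shift (p : A → ℝ) {l k N : ℕ} (h : l + k ≤ N) :
    DependsOn (fun ω => weight p (shift l ω) k) (Iio N) := fun _ _ hxy =>
  weight_congr fun i hi => hxy (l + i) (by simp only [mem_Iio]; omega)

lemma dependsOn_periodize {l n : ℕ} (h : l < n) :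
    DependsOn (periodize l n : (ℕ → A) → ℕ → A) (Iio n) := fun x y hxy => by
  funext i
  have := Nat.mod_lt i (show 0 < n - l by omega)
  exact hxy (l + i % (n - l)) (by simp only [mem_Iio]; omega)

lemma Agree.symm {p : A → ℝ} {δ : ℝ} {x y : ℕ → A} (h : Agree p δ x y) : Agree p δ y x := by
  obtain ⟨k, hk, hxy⟩ := h
  exact ⟨k, by rwa [← weight_congr hxy], fun i hi => (hxy i hi).symm⟩

/-- If `ω` repeats from position `n` on, for `k` letters, what it reads from position `l` on, then
it is periodic on the whole stretch; the two occurrences may overlap. -/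
lemma eq_periodize_of_repeat {l n k : ℕ} (hln : l < n) {ω : ℕ → A}
    (h : ∀ i < k, ω (l + i) = ω (n + i)) :
    ∀ i < k + (n - l), ω (l + i) = periodize l n ω i := by
  intro i
  induction i using Nat.strong_induction_on with
  | _ i ih =>
    intro hi
    by_cases hlt : i < n - l
    · simp only [periodize, Nat.mod_eq_of_lt hlt]
    · obtain ⟨t, rfl⟩ : ∃ t, i = t + (n - l) := ⟨i - (n - l), by omega⟩
      have h1 := ih t (by omega) (by omega)
      rw [show l + (t + (n - l)) = n + t by omega, ← h t (by omega), h1]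
      simp [periodize]

lemma agree_shift_iff {p : A → ℝ} {δ : ℝ} {l n : ℕ} (hln : l < n) (ω : ℕ → A) :
    Agree p δ (shift l ω) (shift n ω) ↔ Agree p δ (periodize l n ω) (shift n ω) := by
  constructor
  · rintro ⟨k, hk, h⟩
    have h' := eq_periodize_of_repeat hln (k := k) h
    have h1 : ∀ i < k, shift l ω i = periodize l n ω i := fun i hi => h' i (by omega)
    exact ⟨k, by rwa [← weight_congr h1], fun i hi => by rw [← h1 i hi, h i hi]⟩
  · rintro ⟨k, hk, h⟩
    have h1 : ∀ i < k + (n - l), shift l ω i = periodize l n ω i := by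
      intro i hi
      by_cases hlt : i < n - l
      · simp only [shift, periodize, Nat.mod_eq_of_lt hlt]
      · obtain ⟨t, rfl⟩ : ∃ t, i = t + (n - l) := ⟨i - (n - l), by omega⟩
        have h2 := h t (by omega)
        simp only [shift] at h2 ⊢
        rw [show l + (t + (n - l)) = n + t by omega, ← h2]
        simp [periodize]
    have h2 : ∀ i < k, shift l ω i = periodize l n ω i := fun i hi => h1 i (by omega)
    exact ⟨k, by rwa [weight_congr h2], fun i hi => by rw [h2 i hi, h i hi]⟩

lemma weight_pos {p : A → ℝ} (hp : ∀ a, 0 < p a) (x : ℕ → A) (k : ℕ) : 0 < weight p x k :=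
  Finset.prod_pos fun _ _ => hp _

lemma weight_le_pow {p : A → ℝ} (hp : ∀ a, 0 < p a) {ρ : ℝ} (hρ : ∀ a, p a ≤ ρ) (x : ℕ → A)
    (k : ℕ) : weight p x k ≤ ρ ^ k := by
  have := Finset.prod_le_prod (s := Finset.range k) (f := fun i => p (x i)) (g := fun _ => ρ)
    (fun i _ => (hp _).le) fun i _ => hρ _
  simpa [weight] using this


end SymbolicRecurrence

namespace SymbolicRecurrence

variable {A : Type*}

/-! ### The Bernoulli measure -/

variable [MeasurableSpace A]

lemma measurable_shift (n : ℕ) : Measurable (shift n : (ℕ → A) → ℕ → A) :=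
  measurable_pi_lambda _ fun i => measurable_pi_apply (n + i)

lemma measurable_glue (N : ℕ) :
    Measurable fun q : (ℕ → A) × (ℕ → A) => glue N q.1 q.2 := by
  refine measurable_pi_lambda _ fun i => ?_
  by_cases h : i < N
  · simp only [glue, h, if_true]
    exact (measurable_pi_apply i).comp measurable_fst
  · simp only [glue, h, if_false]
    exact (measurable_pi_apply (i - N)).comp measurable_snd

variable [Fintype A]

/-- The Bernoulli measure on sequences with weights `p`. -/
noncomputable abbrev bernoulli (p : A → ℝ) : Measure (ℕ → A) :=
  Measure.infinitePi fun _ : ℕ => IFS.letterMeasure p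

variable {p : A → ℝ} [IsProbabilityMeasure (IFS.letterMeasure p)]

/-- The first `N` letters are independent of the remaining ones, which again form a Bernoulli
sequence. -/
lemma measurePreserving_glue (N : ℕ) :
    MeasurePreserving (fun q : (ℕ → A) × (ℕ → A) => glue N q.1 q.2)
      ((bernoulli p).prod (bernoulli p)) (bernoulli p) := by
  classical
  refine ⟨measurable_glue N, Measure.eq_infinitePi _ fun s t ht => ?_⟩
  have hinj : InjOn (fun i => i - N) (s.filter fun i => ¬ i < N : Finset ℕ) := by
    intro i hi j hj hij
    simp only [Finset.coe_filter, mem_ofPred_eq] at hi hj hij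
    omega
  have hpre : (fun q : (ℕ → A) × (ℕ → A) => glue N q.1 q.2) ⁻¹' Set.pi (s : Set ℕ) t =
      Set.pi (s.filter (· < N) : Finset ℕ) t ×ˢ
        Set.pi ((s.filter fun i => ¬ i < N).image (fun i => i - N) : Finset ℕ)
          (fun i => t (i + N)) := by
    ext ⟨ω, η⟩
    simp only [mem_preimage, Set.mem_pi, mem_prod, Finset.mem_coe, Finset.mem_filter,
      Finset.mem_image]
    constructor
    · intro h
      refine ⟨fun i hi => by simpa [glue, hi.2] using h i hi.1, ?_⟩
      rintro _ ⟨i, ⟨hi, hN⟩, rfl⟩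
      rw [Nat.sub_add_cancel (by omega)]
      simpa [glue, hN] using h i hi
    · rintro ⟨h1, h2⟩ i hi
      by_cases hN : i < N
      · simpa [glue, hN] using h1 i ⟨hi, hN⟩
      · have := h2 _ ⟨i, ⟨hi, hN⟩, rfl⟩
        rw [Nat.sub_add_cancel (by omega)] at this
        simpa [glue, hN] using this
  rw [Measure.map_apply (measurable_glue N)
    (MeasurableSet.pi (Finset.countable_toSet _) fun i _ => ht i), hpre, Measure.prod_prod,
    Measure.infinitePi_pi _ fun i _ => ht i, Measure.infinitePi_pi _ fun i _ => ht (i + N),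
    Finset.prod_image hinj, ← Finset.prod_filter_mul_prod_filter_not s (· < N)]
  congr 1
  refine Finset.prod_congr rfl fun i hi => ?_
  rw [Nat.sub_add_cancel (by simp only [Finset.mem_filter] at hi; omega)]

/-- The integral is at most the one obtained by conditioning on the first `N` letters; no
measurability is needed for this direction. -/
lemma lintegral_le_lintegral_glue (N : ℕ) (F : (ℕ → A) → ℝ≥0∞) :
    ∫⁻ ω, F ω ∂(bernoulli p) ≤
      ∫⁻ ω, ∫⁻ η, F (glue N ω η) ∂(bernoulli p) ∂(bernoulli p) := by
  conv_lhs => rw [← (measurePreserving_glue (p := p) N).map_eq]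
  exact (lintegral_map_le _ _).trans (lintegral_prod_le _)

variable [MeasurableSingletonClass A]

lemma letterMeasure_singleton (p : A → ℝ) (a : A) :
    IFS.letterMeasure p {a} = ENNReal.ofReal (p a) := by
  classical
  simp only [IFS.letterMeasure, Measure.coe_finsetSum, Finset.sum_apply, Measure.smul_apply,
    smul_eq_mul, Measure.dirac_apply' _ (measurableSet_singleton a), Set.indicator_apply,
    mem_singleton_iff, Pi.one_apply, mul_ite, mul_one, mul_zero, Finset.sum_ite_eq',
    Finset.mem_univ, if_true]

lemma bernoulli_cylinder (hp : ∀ a, 0 < p a) (x : ℕ → A) (k : ℕ) :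
    bernoulli p {η | ∀ i < k, x i = η i} = ENNReal.ofReal (weight p x k) := by
  have : {η : ℕ → A | ∀ i < k, x i = η i} =
      Set.pi (Finset.range k : Set ℕ) (fun i => {x i}) := by
    ext η
    simp only [mem_ofPred_eq, Set.mem_pi, Finset.mem_coe, Finset.mem_range, mem_singleton_iff,
      eq_comm]
  rw [this, Measure.infinitePi_pi _ fun i _ => measurableSet_singleton _, weight,
    ENNReal.ofReal_prod_of_nonneg fun i _ => (hp _).le]
  exact Finset.prod_congr rfl fun i _ => letterMeasure_singleton p _

lemma bernoulli_agree_le (hp : ∀ a, 0 < p a) (δ : ℝ) (x : ℕ → A) :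
    bernoulli p {η | Agree p δ x η} ≤ ENNReal.ofReal δ := by
  classical
  by_cases hex : ∃ k, weight p x k ≤ δ
  · calc bernoulli p {η | Agree p δ x η}
        ≤ bernoulli p {η | ∀ i < Nat.find hex, x i = η i} := by
          refine measure_mono ?_
          rintro η ⟨k, hk, h⟩ i hi
          exact h i (hi.trans_le (Nat.find_min' hex hk))
      _ = ENNReal.ofReal (weight p x (Nat.find hex)) := bernoulli_cylinder hp _ _
      _ ≤ ENNReal.ofReal δ := ENNReal.ofReal_le_ofReal (Nat.find_spec hex)
  · have : {η | Agree p δ x η} = ∅ := by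
      ext η
      simp only [mem_ofPred_eq, mem_empty_iff_false, iff_false]
      rintro ⟨k, hk, -⟩
      exact hex ⟨k, hk⟩
    simp [this]

/-- The prefix cut at weight `δ` has weight comparable to `δ`. -/
lemma le_bernoulli_agree (hp : ∀ a, 0 < p a) {κ ρ : ℝ} (hκ0 : 0 ≤ κ) (hκ : ∀ a, κ ≤ p a)
    (hκ1 : κ ≤ 1) (hρ : ∀ a, p a ≤ ρ) (hρ1 : ρ < 1) {δ : ℝ} (hδ0 : 0 < δ)
    (hδ1 : δ ≤ 1) (x : ℕ → A) :
    ENNReal.ofReal (κ * δ) ≤ bernoulli p {η | Agree p δ x η} := by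
  classical
  have hex : ∃ k, weight p x k ≤ δ := by
    obtain ⟨k, hk⟩ := exists_pow_lt_of_lt_one hδ0 hρ1
    exact ⟨k, (weight_le_pow hp hρ x k).trans hk.le⟩
  have hlow : κ * δ ≤ weight p x (Nat.find hex) := by
    rcases hk : Nat.find hex with _ | k
    · calc κ * δ ≤ 1 * 1 := mul_le_mul hκ1 hδ1 hδ0.le zero_le_one
        _ = weight p x 0 := by simp [weight]
    · have h1 : ¬ weight p x k ≤ δ := Nat.find_min hex (by omega)
      rw [weight_succ, mul_comm]
      exact mul_le_mul (not_le.1 h1).le (hκ _) hκ0 (weight_pos hp x k).le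
  calc ENNReal.ofReal (κ * δ) ≤ ENNReal.ofReal (weight p x (Nat.find hex)) :=
        ENNReal.ofReal_le_ofReal hlow
    _ = bernoulli p {η | ∀ i < Nat.find hex, x i = η i} := (bernoulli_cylinder hp _ _).symm
    _ ≤ bernoulli p {η | Agree p δ x η} := by
        refine measure_mono fun η h => ?_
        exact ⟨Nat.find hex, Nat.find_spec hex, h⟩

/-- Conditionally on the first `N` letters, the remaining sequence agrees with a sequence determined
by these letters up to weight `c` with probability at most `c`. -/
lemma lintegral_indicator_agree_le (hp : ∀ a, 0 < p a) (N : ℕ) {f : (ℕ → A) → ℝ≥0∞}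
    {c : (ℕ → A) → ℝ} {z : (ℕ → A) → ℕ → A} (hf : DependsOn f (Iio N))
    (hc : DependsOn c (Iio N)) (hz : DependsOn z (Iio N)) :
    ∫⁻ ω, {ω | Agree p (c ω) (z ω) (shift N ω)}.indicator f ω ∂(bernoulli p) ≤
      ∫⁻ ω, f ω * ENNReal.ofReal (c ω) ∂(bernoulli p) := by
  refine (lintegral_le_lintegral_glue N _).trans (lintegral_mono fun ω => ?_)
  have : ∀ η, {ω | Agree p (c ω) (z ω) (shift N ω)}.indicator f (glue N ω η) =
      {η | Agree p (c ω) (z ω) η}.indicator (fun _ => f ω) η := by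
    intro η
    have h : glue N ω η ∈ {ω | Agree p (c ω) (z ω) (shift N ω)} ↔
        η ∈ {η | Agree p (c ω) (z ω) η} := by
      simp only [mem_ofPred_eq, DependsOn.glue_eq hc, DependsOn.glue_eq hz, shift_glue]
    by_cases hη : η ∈ {η | Agree p (c ω) (z ω) η}
    · rw [indicator_of_mem hη, indicator_of_mem (h.2 hη), DependsOn.glue_eq hf]
    · rw [indicator_of_notMem hη, indicator_of_notMem (mt h.1 hη)]
  simp only [this]
  exact (lintegral_indicator_const_le _ _).trans
    (mul_le_mul' le_rfl (bernoulli_agree_le hp _ _))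

lemma measurable_weight (p : A → ℝ) (k : ℕ) : Measurable fun x : ℕ → A => weight p x k :=
  Finset.measurable_prod _ fun i _ => (measurable_of_finite p).comp (measurable_pi_apply i)

lemma measurableSet_agree (p : A → ℝ) (δ : ℝ) :
    MeasurableSet {q : (ℕ → A) × (ℕ → A) | Agree p δ q.1 q.2} := by
  have : {q : (ℕ → A) × (ℕ → A) | Agree p δ q.1 q.2} =
      ⋃ k, ({q | weight p q.1 k ≤ δ} ∩ ⋂ i, ⋂ (_ : i < k), {q | q.1 i = q.2 i}) := by
    ext q
    simp [Agree]
  rw [this]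
  refine MeasurableSet.iUnion fun k => MeasurableSet.inter ?_
    (MeasurableSet.iInter fun i => MeasurableSet.iInter fun _ => ?_)
  · exact measurableSet_le ((measurable_weight p k).comp measurable_fst) measurable_const
  · exact measurableSet_eq_fun ((measurable_pi_apply i).comp measurable_fst)
      ((measurable_pi_apply i).comp measurable_snd)

lemma measurableSet_recurSet (p : A → ℝ) (δ : ℝ) (n l : ℕ) : MeasurableSet (recurSet p δ n l) :=
  ((measurable_shift l).prodMk (measurable_shift n)) (measurableSet_agree p δ)

/-- Conditionally on the first `n` letters, a recurrence at time `n` has probability at most `δ`. -/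
lemma bernoulli_inter_recurSet_le (hp : ∀ a, 0 < p a) (δ : ℝ) {n l : ℕ} (hln : l < n)
    {E : Set (ℕ → A)} (hE : DependsOn (· ∈ E) (Iio n)) (hEm : MeasurableSet E) :
    bernoulli p (E ∩ recurSet p δ n l) ≤ bernoulli p E * ENNReal.ofReal δ := by
  classical
  have hf : DependsOn (E.indicator (1 : (ℕ → A) → ℝ≥0∞)) (Iio n) := fun x y hxy => by
    have : (x ∈ E) = (y ∈ E) := hE hxy
    simp only [Set.indicator_apply, this, Pi.one_apply]
  have h := lintegral_indicator_agree_le hp n hf (fun _ _ _ => rfl : DependsOn (fun _ => δ) _)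
    (dependsOn_periodize hln)
  simp only [← agree_shift_iff hln] at h
  rw [lintegral_mul_const' _ _ ENNReal.ofReal_ne_top, lintegral_indicator_one hEm] at h
  refine le_trans (le_of_eq ?_) h
  rw [← lintegral_indicator_one (hEm.inter (measurableSet_recurSet p δ n l)), indicator_indicator,
    inter_comm]
  rfl

lemma bernoulli_recurSet_le (hp : ∀ a, 0 < p a) (δ : ℝ) {n l : ℕ} (hln : l < n) :
    bernoulli p (recurSet p δ n l) ≤ ENNReal.ofReal δ := by
  have h := bernoulli_inter_recurSet_le hp δ hln (E := univ) (fun _ _ _ => rfl) MeasurableSet.univ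
  simpa only [univ_inter, measure_univ, one_mul] using h

lemma le_bernoulli_recurSet (hp : ∀ a, 0 < p a) {κ ρ : ℝ} (hκ0 : 0 ≤ κ) (hκ : ∀ a, κ ≤ p a)
    (hκ1 : κ ≤ 1) (hρ : ∀ a, p a ≤ ρ) (hρ1 : ρ < 1) {δ : ℝ} (hδ0 : 0 < δ)
    (hδ1 : δ ≤ 1) {n l : ℕ} (hln : l < n) :
    ENNReal.ofReal (κ * δ) ≤ bernoulli p (recurSet p δ n l) := by
  have hm := measurableSet_recurSet p δ n l
  rw [← (measurePreserving_glue (p := p) n).measure_preimage hm.nullMeasurableSet,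
    Measure.prod_apply (measurable_glue n hm)]
  calc ENNReal.ofReal (κ * δ) = ∫⁻ _, ENNReal.ofReal (κ * δ) ∂(bernoulli p) := by simp
    _ ≤ _ := lintegral_mono fun ω => ?_
  refine (le_bernoulli_agree hp hκ0 hκ hκ1 hρ hρ1 hδ0 hδ1 (periodize l n ω)).trans
    (measure_mono fun η hη => ?_)
  simp only [mem_preimage, recurSet, mem_ofPred_eq, agree_shift_iff hln, shift_glue,
    DependsOn.glue_eq (dependsOn_periodize hln)]
  exact hη

end SymbolicRecurrence

namespace SymbolicRecurrence

variable {A : Type*}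

/-! ### Correlations between recurrences -/

/-- The event that the cut prefix of `σˡ ω` has length at most `j` and recurs at position `n`. -/
def shortRecurSet (p : A → ℝ) (δ : ℝ) (n l j : ℕ) : Set (ℕ → A) :=
  {ω | ∃ k ≤ j, weight p (shift l ω) k ≤ δ ∧ ∀ i < k, ω (l + i) = ω (n + i)}

/-- The event that `σ^{l+j} ω` and `σ^{l'} ω` agree so far that the prefix of `σˡ ω` cut at weight
`δ` is covered, where only common prefixes of length at most `K` are considered. -/
def overlapSet (p : A → ℝ) (δ : ℝ) (l j l' K : ℕ) : Set (ℕ → A) :=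
  {ω | ∃ k ≤ K, weight p (shift (l + j) ω) k ≤ δ / weight p (shift l ω) j ∧
    ∀ i < k, ω (l + j + i) = ω (l' + i)}

/-- The sequence that reads `j` letters of `ω` from position `l` on and then the letters from
position `l'` on; letters of `ω` at positions `≥ n` are replaced by the arbitrary letter `ω 0`, so
that the sequence is determined by the first `n` letters. -/
def splice (n l j l' : ℕ) (ω : ℕ → A) : ℕ → A := fun i =>
  if i < j then ω (l + i) else if l' + (i - j) < n then ω (l' + (i - j)) else ω 0

lemma dependsOn_mem_shortRecurSet (p : A → ℝ) (δ : ℝ) {n l : ℕ} (j : ℕ) (hln : l ≤ n) :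
    DependsOn (· ∈ shortRecurSet p δ n l j) (Iio (n + j)) := by
  intro x y hxy
  have hw : ∀ k ≤ j, weight p (shift l x) k = weight p (shift l y) k := fun k hk =>
    dependsOn_weight_shift p (show l + k ≤ n + j by omega) hxy
  refine propext (exists_congr fun k => and_congr_right fun hk => ?_)
  rw [hw k hk]
  refine and_congr_right fun _ => forall₂_congr fun i hi => ?_
  rw [hxy (l + i) (by simp only [mem_Iio]; omega), hxy (n + i) (by simp only [mem_Iio]; omega)]

lemma dependsOn_mem_overlapSet (p : A → ℝ) (δ : ℝ) {n l j l' K : ℕ} (h : l + j + K ≤ n)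
    (h' : l' + K ≤ n) : DependsOn (· ∈ overlapSet p δ l j l' K) (Iio n) := by
  intro x y hxy
  refine propext (exists_congr fun k => and_congr_right fun hk => ?_)
  have h1 : weight p (shift (l + j) x) k = weight p (shift (l + j) y) k :=
    dependsOn_weight_shift p (show l + j + k ≤ n by omega) hxy
  have h2 : weight p (shift l x) j = weight p (shift l y) j :=
    dependsOn_weight_shift p (show l + j ≤ n by omega) hxy
  rw [h1, h2]
  refine and_congr_right fun _ => forall₂_congr fun i hi => ?_
  rw [hxy (l + j + i) (by simp only [mem_Iio]; omega),
    hxy (l' + i) (by simp only [mem_Iio]; omega)]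

lemma dependsOn_splice {n l j : ℕ} (l' : ℕ) (hn : 0 < n) (h : l + j ≤ n) :
    DependsOn (splice n l j l' : (ℕ → A) → ℕ → A) (Iio n) := by
  intro x y hxy
  funext i
  simp only [splice]
  split_ifs with h1 h2
  · exact hxy _ (by simp only [mem_Iio]; omega)
  · exact hxy _ h2
  · exact hxy _ hn

/-- If `ω` recurs at the times `n` and `n + j`, then either the first recurrence is over before
time `n + j`, or the two overlap, in which case the second one outlasts the first one
(by `hdom`) and `σⁿ ω` is determined up to weight `weight p (σˡ ω) j * δ'`. -/
lemma recurSet_inter_subset {p : A → ℝ} (hp : ∀ a, 0 < p a) {ρ : ℝ} (hρ : ∀ a, p a ≤ ρ)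
    {δ δ' : ℝ} {n j l l' K K' : ℕ} (hK : ρ ^ K ≤ δ) (hK' : ρ ^ K' ≤ δ')
    (hnear : j < K → l' + K' ≤ n) (hdom : ρ ^ j * δ' ≤ δ) {ω : ℕ → A}
    (h : ω ∈ recurSet p δ n l) (h' : ω ∈ recurSet p δ' (n + j) l') :
    ω ∈ shortRecurSet p δ n l j ∨
      (j < K ∧ ω ∈ overlapSet p δ l j l' (min (K - j) K') ∧
        Agree p (weight p (shift l ω) j * δ') (splice n l j l' ω) (shift n ω)) := by
  classical
  have hδ'0 : 0 ≤ δ' := (pow_nonneg ((hp (ω 0)).le.trans (hρ _)) _).trans hK'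
  have hex : ∃ k, weight p (shift l ω) k ≤ δ := ⟨K, (weight_le_pow hp hρ _ K).trans hK⟩
  have hex' : ∃ k, weight p (shift l' ω) k ≤ δ' := ⟨K', (weight_le_pow hp hρ _ K').trans hK'⟩
  obtain ⟨k, hk, hkmin, hkK, hagr⟩ : ∃ k, weight p (shift l ω) k ≤ δ ∧
      (∀ m, weight p (shift l ω) m ≤ δ → k ≤ m) ∧ k ≤ K ∧ ∀ i < k, ω (l + i) = ω (n + i) := by
    obtain ⟨m, hm, hagr⟩ := h
    exact ⟨Nat.find hex, Nat.find_spec hex, fun m hm => Nat.find_min' hex hm,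
      Nat.find_min' hex ((weight_le_pow hp hρ _ K).trans hK),
      fun i hi => hagr i (hi.trans_le (Nat.find_min' hex hm))⟩
  obtain ⟨k', hk', hkK', hagr'⟩ : ∃ k, weight p (shift l' ω) k ≤ δ' ∧ k ≤ K' ∧
      ∀ i < k, ω (l' + i) = ω (n + j + i) := by
    obtain ⟨m, hm, hagr⟩ := h'
    exact ⟨Nat.find hex', Nat.find_spec hex',
      Nat.find_min' hex' ((weight_le_pow hp hρ _ K').trans hK'),
      fun i hi => hagr i (hi.trans_le (Nat.find_min' hex' hm))⟩
  -- `k` and `k'` are the lengths of the cut prefixes at `l` and `l'`.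
  by_cases hkj : k ≤ j
  · exact Or.inl ⟨k, hkj, hk, hagr⟩
  push Not at hkj
  right
  have hq := weight_pos hp (shift l ω) j
  have hkk : k ≤ j + k' := by
    by_contra! hlt
    have h1 : weight p (shift j (shift l ω)) k' = weight p (shift l' ω) k' := by
      refine weight_congr fun i hi => ?_
      simp only [shift]
      rw [hagr (j + i) (by omega), hagr' i hi, add_assoc]
    have h2 : weight p (shift l ω) (j + k') ≤ δ := by
      rw [weight_add, h1]
      exact (mul_le_mul (weight_le_pow hp hρ _ j) hk' (weight_pos hp _ _).le
        (hq.le.trans (weight_le_pow hp hρ _ j))).trans hdom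
    have := hkmin _ h2
    omega
  have hn := hnear (by omega)
  refine ⟨by omega, ⟨k - j, by omega, ?_, fun i hi => ?_⟩, j + k', ?_, fun i hi => ?_⟩
  · rw [le_div_iff₀ hq, ← shift_shift, mul_comm, ← weight_add]
    rwa [Nat.add_sub_cancel' hkj.le]
  · rw [hagr' i (by omega), add_assoc, hagr (j + i) (by omega), add_assoc]
  · have h1 : weight p (splice n l j l' ω) j = weight p (shift l ω) j :=
      weight_congr fun i hi => by simp [splice, shift, hi]
    have h2 : weight p (shift j (splice n l j l' ω)) k' = weight p (shift l' ω) k' :=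
      weight_congr fun i hi => by
        simp [splice, shift, show l' + i < n by omega]
    rw [weight_add, h1, h2]
    exact mul_le_mul_of_nonneg_left hk' hq.le
  · by_cases hij : i < j
    · simp only [splice, hij, if_true, shift]
      exact hagr i (by omega)
    · simp only [splice, hij, if_false, shift, show l' + (i - j) < n by omega, if_true]
      rw [hagr' _ (by omega)]
      congr 1
      omega

variable [MeasurableSpace A] [MeasurableSingletonClass A] [Fintype A]

lemma measurableSet_of_dependsOn {N : ℕ} {E : Set (ℕ → A)} (hE : DependsOn (· ∈ E) (Iio N)) :
    MeasurableSet E := by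
  have h : E = (fun (ω : ℕ → A) (i : Fin N) => ω i) ⁻¹'
      ((fun (ω : ℕ → A) (i : Fin N) => ω i) '' E) := by
    refine (subset_preimage_image _ E).antisymm ?_
    rintro ω ⟨ω', hω', h⟩
    have : (ω' ∈ E) = (ω ∈ E) := hE fun i hi => congrFun h ⟨i, hi⟩
    exact this ▸ hω'
  rw [h]
  exact (measurable_pi_lambda _ fun i => measurable_pi_apply _) (Set.toFinite _).measurableSet

variable {p : A → ℝ} [IsProbabilityMeasure (IFS.letterMeasure p)]

/-- Averaged over the past, two distinct positions carry a word that covers the overlap of two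
recurrences with the same probability as if all letters were independent. -/
lemma lintegral_overlapSet_le (hp : ∀ a, 0 < p a) (δ : ℝ) {l j l' : ℕ} (K : ℕ)
    (hne : l' ≠ l + j) :
    ∫⁻ ω, (overlapSet p δ l j l' K).indicator
      (fun ω => ENNReal.ofReal (weight p (shift l ω) j)) ω ∂(bernoulli p) ≤ ENNReal.ofReal δ := by
  set N := max l' (l + j) with hN
  set s := min l' (l + j) with hs
  have hsN : s < N := by omega
  have hq : DependsOn (fun ω : ℕ → A => weight p (shift l ω) j) (Iio N) :=
    dependsOn_weight_shift p (le_max_right _ _)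
  have h := lintegral_indicator_agree_le hp N (f := fun ω => ENNReal.ofReal (weight p (shift l ω) j))
    (c := fun ω => δ / weight p (shift l ω) j) (fun x y hxy => congrArg _ (hq hxy))
    (fun x y hxy => congrArg (δ / ·) (hq hxy)) (dependsOn_periodize hsN)
  -- The weight of the first `j` letters cancels against the probability of the agreement.
  have hconst : ∀ ω : ℕ → A, ENNReal.ofReal (weight p (shift l ω) j) *
      ENNReal.ofReal (δ / weight p (shift l ω) j) = ENNReal.ofReal δ := fun ω => by
    have hpos := weight_pos hp (shift l ω) j
    rw [← ENNReal.ofReal_mul hpos.le, mul_div_cancel₀ _ hpos.ne']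
  simp only [hconst, lintegral_const, measure_univ, mul_one] at h
  refine (lintegral_mono fun ω => ?_).trans h
  refine indicator_le_indicator_of_subset ?_ (fun _ => zero_le) ω
  rintro ω ⟨k, -, hk, hagr⟩
  have h1 : Agree p (δ / weight p (shift l ω) j) (shift (l + j) ω) (shift l' ω) := ⟨k, hk, hagr⟩
  simp only [mem_ofPred_eq]
  rw [← agree_shift_iff hsN]
  rcases lt_or_gt_of_ne hne with hlt | hlt
  · rw [show s = l' by omega, show N = l + j by omega]
    exact h1.symm
  · rw [show s = l + j by omega, show N = l' by omega]
    exact h1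

/-- Recurrences at the times `n` and `n + j` are quasi-independent, with an additional term, decaying
exponentially in `j`, if the second one continues the first one. -/
lemma bernoulli_recurSet_inter_le (hp : ∀ a, 0 < p a) {ρ : ℝ} (hρ : ∀ a, p a ≤ ρ)
    {δ δ' : ℝ} {n j l l' K K' : ℕ} (hK : ρ ^ K ≤ δ) (hK' : ρ ^ K' ≤ δ')
    (hl : l < n) (hlK : l + K ≤ n) (hl' : l' < n + j) (hnear : j < K → l' + K' ≤ n)
    (hdom : ρ ^ j * δ' ≤ δ) :
    bernoulli p (recurSet p δ n l ∩ recurSet p δ' (n + j) l') ≤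
      2 * (ENNReal.ofReal δ * ENNReal.ofReal δ') +
        if l' = l + j then ENNReal.ofReal (ρ ^ j) * ENNReal.ofReal δ' else 0 := by
  classical
  set m := bernoulli p with hm
  set E := shortRecurSet p δ n l j
  set M := recurSet p δ n l
  set M' := recurSet p δ' (n + j) l'
  have hEd : DependsOn (· ∈ E) (Iio (n + j)) := dependsOn_mem_shortRecurSet p δ j hl.le
  have hEm : MeasurableSet E := measurableSet_of_dependsOn hEd
  have hMm : MeasurableSet M := measurableSet_recurSet p δ n l
  have hMm' : MeasurableSet M' := measurableSet_recurSet p δ' (n + j) l'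
  have h1 : m (E ∩ M') ≤ ENNReal.ofReal δ * ENNReal.ofReal δ' := by
    refine (bernoulli_inter_recurSet_le hp δ' hl' hEd hEm).trans (mul_le_mul_left ?_ _)
    refine (measure_mono ?_).trans (bernoulli_recurSet_le hp δ hl)
    rintro ω ⟨k, -, hk, hagr⟩
    exact ⟨k, hk, hagr⟩
  set D := (M ∩ M') \ E with hD
  have h2 : m D ≤ ENNReal.ofReal δ * ENNReal.ofReal δ' +
      if l' = l + j then ENNReal.ofReal (ρ ^ j) * ENNReal.ofReal δ' else 0 := by
    by_cases hjK : j < K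
    swap
    · have : D = ∅ := by
        refine eq_empty_of_forall_notMem ?_
        rintro ω ⟨⟨hω, hω'⟩, hωE⟩
        rcases recurSet_inter_subset hp hρ hK hK' hnear hdom hω hω' with h | h
        · exact hωE h
        · exact hjK h.1
      simp [this]
    set C := overlapSet p δ l j l' (min (K - j) K') with hC
    have hln := hnear hjK
    have hCd : DependsOn (· ∈ C) (Iio n) :=
      dependsOn_mem_overlapSet p δ (by omega) (by omega)
    have hf : DependsOn (C.indicator (1 : (ℕ → A) → ℝ≥0∞)) (Iio n) := fun x y hxy => by
      have : (x ∈ C) = (y ∈ C) := hCd hxy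
      simp only [Set.indicator_apply, this, Pi.one_apply]
    have hq : DependsOn (fun ω : ℕ → A => weight p (shift l ω) j * δ') (Iio n) := fun x y hxy =>
      congrArg (· * δ') (dependsOn_weight_shift p (show l + j ≤ n by omega) hxy)
    have h3 := lintegral_indicator_agree_le hp n hf hq
      (dependsOn_splice l' (show 0 < n by omega) (show l + j ≤ n by omega))
    have h4 : m D ≤
        (∫⁻ ω, C.indicator (fun ω => ENNReal.ofReal (weight p (shift l ω) j)) ω ∂m) *
        ENNReal.ofReal δ' := by
      rw [← lintegral_indicator_one ((hMm.inter hMm').diff hEm),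
        ← lintegral_mul_const' _ _ ENNReal.ofReal_ne_top]
      refine le_trans (lintegral_mono fun ω => ?_) (h3.trans (lintegral_mono fun ω => ?_))
      · by_cases hω : ω ∈ D
        · rcases recurSet_inter_subset hp hρ hK hK' hnear hdom hω.1.1 hω.1.2 with h | h
          · exact absurd h hω.2
          · rw [indicator_of_mem hω, indicator_of_mem (by exact h.2.2), indicator_of_mem h.2.1]
        · rw [indicator_of_notMem hω]
          exact zero_le
      · by_cases hω : ω ∈ C
        · rw [indicator_of_mem hω, indicator_of_mem hω, Pi.one_apply, one_mul,
            ENNReal.ofReal_mul (weight_pos hp _ _).le]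
        · rw [indicator_of_notMem hω, zero_mul]
          exact zero_le
    refine h4.trans ?_
    split_ifs with hll
    · refine le_trans (mul_le_mul_left ?_ _) le_add_self
      calc _ ≤ ∫⁻ _, ENNReal.ofReal (ρ ^ j) ∂m := lintegral_mono fun ω =>
            (indicator_le_self _ _ ω).trans
              (ENNReal.ofReal_le_ofReal (weight_le_pow hp hρ _ j))
        _ = ENNReal.ofReal (ρ ^ j) := by simp [hm]
    · rw [add_zero]
      exact mul_le_mul_left (lintegral_overlapSet_le hp δ _ hll) _
  calc m (M ∩ M') ≤ m ((E ∩ M') ∪ D) := measure_mono fun ω hω => by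
        by_cases hE : ω ∈ E
        · exact Or.inl ⟨hE, hω.2⟩
        · exact Or.inr ⟨hω, hE⟩
    _ ≤ m (E ∩ M') + m D := measure_union_le _ _
    _ ≤ _ := by
        rw [two_mul, add_assoc]
        exact add_le_add h1 h2

end SymbolicRecurrence

namespace SymbolicRecurrence

/-! ### Second moments -/

/-- The Chung–Erdős inequality. -/
lemma sq_sum_measure_le {Ω ι : Type*} [MeasurableSpace Ω] (μ : Measure Ω) (s : Finset ι)
    (M : ι → Set Ω) (hM : ∀ i, MeasurableSet (M i)) :
    (∑ i ∈ s, μ (M i)) ^ 2 ≤ (∑ i ∈ s, ∑ j ∈ s, μ (M i ∩ M j)) * μ (⋃ i ∈ s, M i) := by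
  classical
  set U := ⋃ i ∈ s, M i with hU
  have hUm : MeasurableSet U := Finset.measurableSet_biUnion s fun i _ => hM i
  set Z : Ω → ℝ≥0∞ := fun ω => ∑ i ∈ s, (M i).indicator 1 ω with hZ
  have hZm : Measurable Z := Finset.measurable_fun_sum _ fun i _ =>
    measurable_one.indicator (hM i)
  have h1 : ∫⁻ ω, Z ω ∂μ = ∑ i ∈ s, μ (M i) := by
    rw [lintegral_finsetSum _ fun i _ => measurable_one.indicator (hM i)]
    exact Finset.sum_congr rfl fun i _ => lintegral_indicator_one (hM i)
  have h2 : ∫⁻ ω, Z ω ^ (2 : ℝ) ∂μ = ∑ i ∈ s, ∑ j ∈ s, μ (M i ∩ M j) := by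
    have : ∀ ω, Z ω ^ (2 : ℝ) = ∑ i ∈ s, ∑ j ∈ s, (M i ∩ M j).indicator 1 ω := by
      intro ω
      rw [ENNReal.rpow_two, sq, hZ, Finset.sum_mul_sum]
      refine Finset.sum_congr rfl fun i _ => Finset.sum_congr rfl fun j _ => ?_
      by_cases hi : ω ∈ M i <;> by_cases hj : ω ∈ M j <;> simp [hi, hj]
    simp only [this]
    rw [lintegral_finsetSum _ fun i _ => Finset.measurable_fun_sum _ fun j _ =>
      measurable_one.indicator ((hM i).inter (hM j))]
    refine Finset.sum_congr rfl fun i _ => ?_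
    rw [lintegral_finsetSum _ fun j _ => measurable_one.indicator ((hM i).inter (hM j))]
    exact Finset.sum_congr rfl fun j _ => lintegral_indicator_one ((hM i).inter (hM j))
  have h3 : ∫⁻ ω, U.indicator (1 : Ω → ℝ≥0∞) ω ^ (2 : ℝ) ∂μ = μ U := by
    rw [← lintegral_indicator_one hUm]
    refine lintegral_congr fun ω => ?_
    by_cases h : ω ∈ U <;> simp [h]
  have h4 : ∀ ω, Z ω = (Z * U.indicator (1 : Ω → ℝ≥0∞)) ω := by
    intro ω
    by_cases h : ω ∈ U
    · simp [h]
    · have : ∀ i ∈ s, ω ∉ M i := fun i hi hω => h (mem_biUnion (x := i) hi hω)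
      simp only [Pi.mul_apply, indicator_of_notMem h, mul_zero, hZ]
      exact Finset.sum_eq_zero fun i hi => indicator_of_notMem (this i hi) _
  have h5 := ENNReal.lintegral_mul_le_Lp_mul_Lq μ Real.HolderConjugate.two_two hZm.aemeasurable
    (measurable_one.indicator hUm : Measurable (U.indicator (1 : Ω → ℝ≥0∞))).aemeasurable
  rw [← lintegral_congr h4, h1, h2, h3] at h5
  calc (∑ i ∈ s, μ (M i)) ^ 2
      ≤ ((∑ i ∈ s, ∑ j ∈ s, μ (M i ∩ M j)) ^ (1 / 2 : ℝ) * μ U ^ (1 / 2 : ℝ)) ^ 2 := by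
        gcongr
    _ = _ := by
        rw [mul_pow, ← ENNReal.rpow_natCast, ← ENNReal.rpow_natCast, ← ENNReal.rpow_mul,
          ← ENNReal.rpow_mul]
        norm_num

/-- The positions at which the recurrences at time `n` are looked for. They tend to infinity
with `n`, and stay away from `n`. -/
def lookback (n : ℕ) : Finset ℕ := Finset.Ico (n / 4) (n / 2)

lemma sum_geometric_back_le (R : ℝ≥0∞) (F : Finset ℕ) (n' : ℕ) :
    ∑ n ∈ F, (if n ≤ n' then R ^ (n' - n) else 0) ≤ (1 - R)⁻¹ := by
  rw [← Finset.sum_filter]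
  have hinj : InjOn (fun n => n' - n) (F.filter (· ≤ n') : Finset ℕ) := by
    intro i hi j hj hij
    simp only [Finset.coe_filter, mem_ofPred_eq] at hi hj hij
    omega
  rw [← Finset.sum_image (f := fun k => R ^ k) hinj, ← ENNReal.tsum_geometric]
  exact ENNReal.sum_le_tsum _

lemma sum_continuation_le (R : ℝ≥0∞) (F : Finset ℕ) (L : ℕ → Finset ℕ) (n' l' : ℕ) :
    ∑ i ∈ F.sigma L, (if i.1 ≤ n' ∧ l' = i.2 + (n' - i.1) then R ^ (n' - i.1) else 0) ≤
      (1 - R)⁻¹ := by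
  rw [Finset.sum_sigma]
  refine (Finset.sum_le_sum fun n _ => ?_).trans (sum_geometric_back_le R F n')
  simp only
  by_cases h : n ≤ n'
  · simp only [h, true_and, if_true]
    rw [← Finset.sum_filter, Finset.sum_const]
    have hcard : ((L n).filter fun l => l' = l + (n' - n)).card ≤ 1 := by
      refine Finset.card_le_one.2 fun a ha b hb => ?_
      simp only [Finset.mem_filter] at ha hb
      omega
    calc _ ≤ 1 • R ^ (n' - n) := nsmul_le_nsmul_left zero_le hcard
      _ = _ := one_nsmul _
  · simp [h]

variable {A : Type*} [MeasurableSpace A] [MeasurableSingletonClass A] [Fintype A]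
  {p : A → ℝ} [IsProbabilityMeasure (IFS.letterMeasure p)]

/-- The correlation bound for the selected times and positions. As `ρ ^ (n / 8) ≤ δ n`, prefixes cut
at weight `δ n` have length at most `n / 8`; read from a position in `lookback n` they end before
time `n`, and for two overlapping recurrences both end before the earlier of the two times. -/
lemma bernoulli_recurSet_inter_le_of_mem (hp : ∀ a, 0 < p a) {ρ : ℝ} (hρ : ∀ a, p a ≤ ρ)
    {δ : ℕ → ℝ} {G : Set ℕ} (hG : ∀ n ∈ G, ρ ^ (n / 8) ≤ δ n)
    (hdom : ∀ n ∈ G, ∀ n' ∈ G, n ≤ n' → ρ ^ (n' - n) * δ n' ≤ δ n) {n n' l l' : ℕ}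
    (hn : n ∈ G) (hn' : n' ∈ G) (hl : l ∈ lookback n) (hl' : l' ∈ lookback n') (hnn : n ≤ n') :
    bernoulli p (recurSet p (δ n) n l ∩ recurSet p (δ n') n' l') ≤
      2 * (ENNReal.ofReal (δ n) * ENNReal.ofReal (δ n')) +
        (if n ≤ n' ∧ l' = l + (n' - n) then ENNReal.ofReal ρ ^ (n' - n) else 0) *
          ENNReal.ofReal (δ n') := by
  obtain ⟨j, rfl⟩ := Nat.exists_eq_add_of_le hnn
  simp only [lookback, Finset.mem_Ico] at hl hl'
  have hd := hdom n hn _ hn' hnn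
  rw [Nat.add_sub_cancel_left] at hd ⊢
  have hρ0 : 0 ≤ ρ := by
    have : Nonempty A := by
      by_contra h
      have h0 : IFS.letterMeasure p univ = 0 := by
        rw [not_nonempty_iff] at h
        rw [univ_eq_empty_iff.2 h, measure_empty]
      rw [measure_univ] at h0
      exact one_ne_zero h0
    exact (hp this.some).le.trans (hρ _)
  refine (bernoulli_recurSet_inter_le hp hρ (hG n hn) (hG _ hn') (by omega) (by omega) (by omega)
    (fun _ => by omega) hd).trans (le_of_eq ?_)
  congr 1
  by_cases h : l' = l + j <;> simp [h, ENNReal.ofReal_pow hρ0]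

/-- The second moment method: recurrences at arbitrarily late times have probability bounded below. -/
lemma exists_le_bernoulli_iUnion_recurSet (hp : ∀ a, 0 < p a) {κ ρ : ℝ} (hκ0 : 0 < κ)
    (hκ : ∀ a, κ ≤ p a) (hκ1 : κ ≤ 1) (hρ : ∀ a, p a ≤ ρ) (hρ1 : ρ < 1)
    {δ : ℕ → ℝ} (hδ1 : ∀ n, δ n < 1) {G : Set ℕ}
    (hG0 : ∀ n ∈ G, 0 < δ n) (hG : ∀ n ∈ G, ρ ^ (n / 8) ≤ δ n)
    (hdom : ∀ n ∈ G, ∀ n' ∈ G, n ≤ n' → ρ ^ (n' - n) * δ n' ≤ δ n)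
    (hdiv : ∑' n, G.indicator (fun n => ENNReal.ofReal (n * δ n)) n = ∞) :
    ∃ c : ℝ≥0∞, 0 < c ∧ ∀ N : ℕ, c ≤ bernoulli p
      (⋃ n ≥ N, ⋃ (_ : n ∈ G), ⋃ l ∈ lookback n, recurSet p (δ n) n l) := by
  classical
  set R := ENNReal.ofReal ρ with hR
  have hR1 : R < 1 := by
    rw [hR, ← ENNReal.ofReal_one]
    exact ENNReal.ofReal_lt_ofReal_iff'.2 ⟨hρ1, one_pos⟩
  set T := (1 - R)⁻¹ with hT
  have hTtop : T ≠ ∞ := ENNReal.inv_ne_top.2 (tsub_pos_of_lt hR1).ne'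
  set k := ENNReal.ofReal κ with hk
  have hk0 : 0 < k := ENNReal.ofReal_pos.2 hκ0
  refine ⟨k ^ 2 / (2 + 2 * T), ENNReal.div_pos (pow_ne_zero 2 hk0.ne') (by finiteness), fun N => ?_⟩
  set d : ℕ → ℝ≥0∞ := fun n => ENNReal.ofReal (δ n) with hd
  set a : ℕ → ℝ≥0∞ := G.indicator fun n => (lookback n).card * d n with ha
  have hatop : ∀ n, a n ≠ ∞ := by
    intro n
    by_cases h : n ∈ G
    · rw [ha, indicator_of_mem h]
      exact ENNReal.mul_ne_top (ENNReal.natCast_ne_top _) ENNReal.ofReal_ne_top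
    · rw [ha, indicator_of_notMem h]
      exact ENNReal.zero_ne_top
  have hasum : ∑' n, a n = ∞ := by
    have hle : ∀ n, G.indicator (fun n => ENNReal.ofReal (n * δ n)) n ≤ 8 * a n := by
      intro n
      by_cases h : n ∈ G
      · have h8 : 8 ≤ n := by
          by_contra! hlt
          have h1 := hG n h
          rw [Nat.div_eq_of_lt hlt, pow_zero] at h1
          exact absurd (hδ1 n) (not_lt.2 h1)
        have hc : n ≤ 8 * (lookback n).card := by
          simp only [lookback, Nat.card_Ico]
          omega
        rw [ha, indicator_of_mem h, indicator_of_mem h, ENNReal.ofReal_mul (Nat.cast_nonneg n),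
          ENNReal.ofReal_natCast, ← mul_assoc]
        refine mul_le_mul_left ?_ _
        exact_mod_cast hc
      · rw [indicator_of_notMem h]
        exact zero_le
    have h8 := ENNReal.tsum_le_tsum hle
    rw [hdiv, ENNReal.tsum_mul_left, top_le_iff] at h8
    by_contra hne
    exact ENNReal.mul_ne_top (by norm_num) hne h8
  -- A finite set of late times whose expected number of recurrences is at least of order `1`.
  obtain ⟨F, hFG, hFN, hF1⟩ : ∃ F : Finset ℕ, (∀ n ∈ F, n ∈ G) ∧ (∀ n ∈ F, N ≤ n) ∧
      1 ≤ ∑ n ∈ F, (lookback n).card * d n := by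
    have hfin : 1 + ∑ n ∈ Finset.range N, a n < ∑' n, a n := by
      rw [hasum, lt_top_iff_ne_top, ENNReal.add_ne_top]
      exact ⟨ENNReal.one_ne_top, ENNReal.sum_ne_top.2 fun n _ => hatop n⟩
    rw [ENNReal.tsum_eq_iSup_sum, lt_iSup_iff] at hfin
    obtain ⟨F, hF⟩ := hfin
    refine ⟨F.filter fun n => n ∈ G ∧ N ≤ n, fun n hn => (Finset.mem_filter.1 hn).2.1,
      fun n hn => (Finset.mem_filter.1 hn).2.2, ?_⟩
    have h1 : ∑ n ∈ F, a n ≤ ∑ n ∈ F.filter (fun n => n ∈ G ∧ N ≤ n), a n +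
        ∑ n ∈ Finset.range N, a n := by
      rw [← Finset.sum_filter_add_sum_filter_not F fun n => n ∈ G ∧ N ≤ n]
      refine add_le_add le_rfl ?_
      refine Finset.sum_le_sum_of_ne_zero fun n hn hne => ?_
      have hnG : n ∈ G := by
        by_contra h
        exact hne (indicator_of_notMem h _)
      have := (Finset.mem_filter.1 hn).2
      simp only [hnG, true_and, not_le] at this
      exact Finset.mem_range.2 this
    have h2 : ∑ n ∈ F.filter (fun n => n ∈ G ∧ N ≤ n), a n =
        ∑ n ∈ F.filter (fun n => n ∈ G ∧ N ≤ n), (lookback n).card * d n :=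
      Finset.sum_congr rfl fun n hn => indicator_of_mem (Finset.mem_filter.1 hn).2.1 _
    rw [← h2]
    have h3 := hF.le.trans h1
    exact (ENNReal.add_le_add_iff_right
      (ENNReal.sum_ne_top.2 fun n _ => hatop n)).1 h3
  set S := ∑ n ∈ F, (lookback n).card * d n with hS
  have hStop : S ≠ ∞ := ENNReal.sum_ne_top.2 fun n _ =>
    ENNReal.mul_ne_top (ENNReal.natCast_ne_top _) ENNReal.ofReal_ne_top
  set I := F.sigma lookback with hI
  set M : (Σ _ : ℕ, ℕ) → Set (ℕ → A) := fun i => recurSet p (δ i.1) i.1 i.2 with hM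
  have hsumI : ∑ i ∈ I, d i.1 = S := by
    rw [hI, Finset.sum_sigma]
    exact Finset.sum_congr rfl fun n _ => by simp
  have hmem : ∀ i ∈ I, i.1 ∈ G ∧ i.2 ∈ lookback i.1 := fun i hi =>
    ⟨hFG _ (Finset.mem_sigma.1 hi).1, (Finset.mem_sigma.1 hi).2⟩
  -- The first moment.
  have hfirst : k * S ≤ ∑ i ∈ I, bernoulli p (M i) := by
    rw [← hsumI, Finset.mul_sum]
    refine Finset.sum_le_sum fun i hi => ?_
    obtain ⟨hiG, hil⟩ := hmem i hi
    have hlt : i.2 < i.1 := by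
      simp only [lookback, Finset.mem_Ico] at hil
      omega
    rw [hk, hd, ← ENNReal.ofReal_mul hκ0.le]
    exact le_bernoulli_recurSet hp hκ0.le hκ hκ1 hρ hρ1 (hG0 _ hiG) (hδ1 _).le hlt
  -- The second moment.
  -- `b i j` is the extra term that occurs when the recurrence `j` continues the recurrence `i`.
  set b : (Σ _ : ℕ, ℕ) → (Σ _ : ℕ, ℕ) → ℝ≥0∞ := fun i j =>
    (if i.1 ≤ j.1 ∧ j.2 = i.2 + (j.1 - i.1) then R ^ (j.1 - i.1) else 0) * d j.1 with hb
  have hpair : ∀ i ∈ I, ∀ j ∈ I,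
      bernoulli p (M i ∩ M j) ≤ 2 * (d i.1 * d j.1) + (b i j + b j i) := by
    intro i hi j hj
    obtain ⟨hiG, hil⟩ := hmem i hi
    obtain ⟨hjG, hjl⟩ := hmem j hj
    rcases le_total i.1 j.1 with h | h
    · refine (bernoulli_recurSet_inter_le_of_mem hp hρ hG hdom hiG hjG hil hjl h).trans ?_
      exact add_le_add le_rfl le_self_add
    · rw [inter_comm, mul_comm (d i.1)]
      refine (bernoulli_recurSet_inter_le_of_mem hp hρ hG hdom hjG hiG hjl hil h).trans ?_
      exact add_le_add le_rfl le_add_self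
  have hbsum : ∑ j ∈ I, ∑ i ∈ I, b i j ≤ T * S := by
    rw [← hsumI, Finset.mul_sum]
    refine Finset.sum_le_sum fun j _ => ?_
    rw [hb, ← Finset.sum_mul]
    exact mul_le_mul_left (sum_continuation_le R F lookback j.1 j.2) _
  have hsecond : ∑ i ∈ I, ∑ j ∈ I, bernoulli p (M i ∩ M j) ≤ (2 + 2 * T) * S ^ 2 := by
    calc ∑ i ∈ I, ∑ j ∈ I, bernoulli p (M i ∩ M j)
        ≤ ∑ i ∈ I, ∑ j ∈ I, (2 * (d i.1 * d j.1) + (b i j + b j i)) :=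
          Finset.sum_le_sum fun i hi => Finset.sum_le_sum fun j hj => hpair i hi j hj
      _ = 2 * (S * S) + (∑ j ∈ I, ∑ i ∈ I, b i j + ∑ j ∈ I, ∑ i ∈ I, b i j) := by
          simp only [Finset.sum_add_distrib, ← Finset.mul_sum]
          rw [← hsumI, Finset.sum_mul_sum, Finset.sum_comm (f := fun i j => b i j)]
          simp only [Finset.mul_sum]
      _ ≤ 2 * (S * S) + (T * S + T * S) := add_le_add le_rfl (add_le_add hbsum hbsum)
      _ ≤ 2 * (S * S) + (T * (S * S) + T * (S * S)) := by
          have : S ≤ S * S := by simpa using mul_le_mul_left hF1 S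
          gcongr
      _ = (2 + 2 * T) * S ^ 2 := by ring
  have hCE := sq_sum_measure_le (bernoulli p) I M fun i => measurableSet_recurSet p _ _ _
  have hfinal : k ^ 2 * S ^ 2 ≤ (bernoulli p (⋃ i ∈ I, M i) * (2 + 2 * T)) * S ^ 2 := by
    calc k ^ 2 * S ^ 2 = (k * S) ^ 2 := by ring
      _ ≤ (∑ i ∈ I, bernoulli p (M i)) ^ 2 := by gcongr
      _ ≤ _ := hCE
      _ ≤ ((2 + 2 * T) * S ^ 2) * bernoulli p (⋃ i ∈ I, M i) := mul_le_mul_left hsecond _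
      _ = _ := by ring
  have hS0 : S ^ 2 ≠ 0 := pow_ne_zero 2 (zero_lt_one.trans_le hF1).ne'
  rw [ENNReal.mul_le_mul_iff_left hS0 (ENNReal.pow_ne_top hStop)] at hfinal
  refine (ENNReal.div_le_of_le_mul hfinal).trans (measure_mono ?_)
  refine iUnion₂_subset fun i hi ω hω => ?_
  obtain ⟨hiG, hil⟩ := hmem i hi
  simp only [mem_iUnion]
  exact ⟨i.1, hFN _ (Finset.mem_sigma.1 hi).1, hiG, i.2, hil, hω⟩

end SymbolicRecurrence

namespace SymbolicRecurrence

/-! ### Selecting the recurrence times -/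

lemma pow_div_eight_mul_le {θ : ℝ} (hθ0 : 0 < θ) (hθ1 : θ < 1) (n : ℕ) :
    (θ ^ 8) ^ (n / 8) * θ ^ 7 ≤ θ ^ n := by
  rw [← pow_mul, ← pow_add]
  exact pow_le_pow_of_le_one hθ0.le hθ1.le (by omega)

lemma summable_mul_pow_div_eight {ρ : ℝ} (hρ0 : 0 < ρ) (hρ1 : ρ < 1) :
    Summable fun n : ℕ => (n : ℝ) * ρ ^ (n / 8) := by
  obtain ⟨θ, hθ0, hθ1, rfl⟩ : ∃ θ : ℝ, 0 < θ ∧ θ < 1 ∧ θ ^ 8 = ρ :=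
    ⟨ρ ^ ((8 : ℕ) : ℝ)⁻¹, Real.rpow_pos_of_pos hρ0 _,
      Real.rpow_lt_one hρ0.le hρ1 (by positivity), Real.rpow_inv_natCast_pow hρ0.le (by norm_num)⟩
  have hθ : Summable fun n : ℕ => (n : ℝ) ^ 1 * θ ^ n :=
    summable_pow_mul_geometric_of_norm_lt_one 1 (by rwa [Real.norm_of_nonneg hθ0.le])
  have hs : Summable fun n : ℕ => (θ ^ 7)⁻¹ * ((n : ℝ) ^ 1 * θ ^ n) := hθ.mul_left _
  refine Summable.of_nonneg_of_le (fun n => by positivity) (fun n => ?_) hs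
  rw [pow_one, ← mul_assoc, mul_comm _ (n : ℝ), mul_assoc]
  refine mul_le_mul_of_nonneg_left ?_ (Nat.cast_nonneg n)
  rw [inv_mul_eq_div, le_div_iff₀ (pow_pos hθ0 7)]
  exact pow_div_eight_mul_le hθ0 hθ1 n

/-- Times `n` that are dominated by a later time `n'`, in the sense that
`δ n < ρ ^ (n' - n) * δ n'`, can be discarded without making the divergent series converge: the
terms charged to one `n'` form a geometric series. So can times with exponentially small `δ n`. -/
lemma exists_undominated_set {ρ : ℝ} (hρ0 : 0 < ρ) (hρ1 : ρ < 1) {δ : ℕ → ℝ}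
    (hδ1 : ∀ n, δ n ≤ 1) (hdiv : ∑' n : ℕ, ENNReal.ofReal (n * δ n) = ∞) :
    ∃ G : Set ℕ, (∀ n ∈ G, ρ ^ (n / 8) ≤ δ n) ∧
      (∀ n ∈ G, ∀ n' ∈ G, n ≤ n' → ρ ^ (n' - n) * δ n' ≤ δ n) ∧
      ∑' n, G.indicator (fun n => ENNReal.ofReal (n * δ n)) n = ∞ := by
  classical
  set G₀ : Set ℕ := {n | ρ ^ (n / 8) ≤ δ n} with hG₀
  have hpos : ∀ n ∈ G₀, 0 < δ n := fun n hn => (pow_pos hρ0 _).trans_le hn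
  set G : Set ℕ := {n | n ∈ G₀ ∧ ∀ n' ∈ G₀, n ≤ n' → δ n' * ρ ^ n' ≤ δ n * ρ ^ n} with hG
  have hscale : ∀ {n n' : ℕ}, n ≤ n' → ρ ^ n' = ρ ^ (n' - n) * ρ ^ n := fun h => by
    rw [← pow_add, Nat.sub_add_cancel h]
  refine ⟨G, fun n hn => hn.1, fun n hn n' hn' h => ?_, ?_⟩
  · have h1 := hn.2 n' hn'.1 h
    rw [hscale h, ← mul_assoc] at h1
    rw [mul_comm]
    exact le_of_mul_le_mul_right h1 (pow_pos hρ0 n)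
  -- Since `δ n * ρ ^ n → 0`, its maximum over the times in `G₀` after `n` is attained, at a time
  -- in `G`.
  have hdom : ∀ n ∈ G₀, ∃ n' ∈ G, n ≤ n' ∧ δ n ≤ ρ ^ (n' - n) * δ n' := by
    intro n hn
    have hfpos : 0 < δ n * ρ ^ n := mul_pos (hpos n hn) (pow_pos hρ0 n)
    set B : Set ℕ := {n' | n' ∈ G₀ ∧ n ≤ n' ∧ δ n * ρ ^ n ≤ δ n' * ρ ^ n'} with hB
    have hBfin : B.Finite := by
      obtain ⟨m, hm⟩ := exists_pow_lt_of_lt_one hfpos hρ1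
      refine (Set.finite_lt_nat m).subset fun n' hn' => ?_
      by_contra hle
      simp only [mem_ofPred_eq, not_lt] at hle
      have h1 : δ n' * ρ ^ n' ≤ 1 * ρ ^ n' :=
        mul_le_mul_of_nonneg_right (hδ1 n') (pow_pos hρ0 _).le
      have h2 : ρ ^ n' ≤ ρ ^ m := pow_le_pow_of_le_one hρ0.le hρ1.le hle
      linarith [hn'.2.2]
    obtain ⟨n', ⟨hn'0, hnn', hfn'⟩, hmax⟩ :=
      hBfin.exists_maximalFor (fun n' => δ n' * ρ ^ n') B ⟨n, hn, le_rfl, le_rfl⟩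
    refine ⟨n', ⟨hn'0, fun m hm hle => ?_⟩, hnn', ?_⟩
    · by_contra! hlt
      exact absurd (hmax ⟨hm, hnn'.trans hle, hfn'.trans hlt.le⟩ hlt.le) (not_le.2 hlt)
    · rw [hscale hnn', ← mul_assoc, mul_comm (δ n')] at hfn'
      exact le_of_mul_le_mul_right hfn' (pow_pos hρ0 n)
  set R := ENNReal.ofReal ρ with hR
  have hR1 : R < 1 := by
    rw [hR, ← ENNReal.ofReal_one]
    exact ENNReal.ofReal_lt_ofReal_iff'.2 ⟨hρ1, one_pos⟩
  set a : ℕ → ℝ≥0∞ := G.indicator fun n => ENNReal.ofReal (n * δ n) with ha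
  have hle : ∀ n : ℕ, ENNReal.ofReal (n * δ n) ≤ ENNReal.ofReal (n * ρ ^ (n / 8)) +
      ∑' n', (if n ≤ n' then R ^ (n' - n) else 0) * a n' := by
    intro n
    by_cases hn : n ∈ G₀
    · obtain ⟨n', hn'G, hnn', h⟩ := hdom n hn
      refine le_trans ?_ (le_add_left (ENNReal.le_tsum n'))
      rw [if_pos hnn', ha, indicator_of_mem hn'G, hR, ← ENNReal.ofReal_pow hρ0.le,
        ← ENNReal.ofReal_mul (pow_pos hρ0 _).le]
      refine ENNReal.ofReal_le_ofReal ?_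
      have hc : (n : ℝ) ≤ n' := by exact_mod_cast hnn'
      calc n * δ n ≤ n' * (ρ ^ (n' - n) * δ n') :=
            mul_le_mul hc h (hpos n hn).le (Nat.cast_nonneg _)
        _ = ρ ^ (n' - n) * (n' * δ n') := by ring
    · refine le_trans (ENNReal.ofReal_le_ofReal ?_) le_self_add
      exact mul_le_mul_of_nonneg_left (not_le.1 hn).le (Nat.cast_nonneg _)
  have h1 := ENNReal.tsum_le_tsum hle
  rw [hdiv, ENNReal.tsum_add, top_le_iff, ENNReal.add_eq_top, ENNReal.tsum_comm] at h1
  rcases h1 with h1 | h1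
  · exact absurd h1 (summable_mul_pow_div_eight hρ0 hρ1).tsum_ofReal_ne_top
  by_contra hne
  have h2 : ∑' n', ∑' n, (if n ≤ n' then R ^ (n' - n) else 0) * a n' ≤
      (1 - R)⁻¹ * ∑' n', a n' := by
    rw [← ENNReal.tsum_mul_left]
    refine ENNReal.tsum_le_tsum fun n' => ?_
    rw [ENNReal.tsum_mul_right]
    refine mul_le_mul_left ?_ _
    rw [ENNReal.tsum_eq_iSup_sum]
    exact iSup_le fun F => sum_geometric_back_le R F n'
  rw [h1, top_le_iff] at h2
  exact ENNReal.mul_ne_top (ENNReal.inv_ne_top.2 (tsub_pos_of_lt hR1).ne') hne h2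

/-! ### The zero-one law -/

variable {A : Type*} [MeasurableSpace A] [MeasurableSingletonClass A] [Fintype A]
  {p : A → ℝ}

lemma measurableSet_tail_recurSet (p : A → ℝ) (δ : ℝ) {N n l : ℕ} (hl : N ≤ l) (hn : N ≤ n) :
    MeasurableSet[⨆ i ≥ N, MeasurableSpace.comap (fun ω : ℕ → A => ω i) inferInstance]
      (recurSet p δ n l) := by
  have hshift : ∀ m, N ≤ m →
      @Measurable _ _ (⨆ i ≥ N, MeasurableSpace.comap (fun ω : ℕ → A => ω i) inferInstance) _
        (shift m : (ℕ → A) → ℕ → A) := fun m hm => by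
    refine @measurable_pi_lambda _ _ _ (_) _ _ fun i => ?_
    refine Measurable.of_comap_le ?_
    exact le_iSup₂_of_le (m + i) (show m + i ≥ N by omega) le_rfl
  exact (@Measurable.prodMk _ _ _ _ _ (_) _ _ (hshift l hl) (hshift n hn))
    (measurableSet_agree p δ)

variable [IsProbabilityMeasure (IFS.letterMeasure p)]

/-- Kolmogorov's law for the event that recurrences happen at infinitely many times. -/
lemma bernoulli_limsup_recurSet_eq_zero_or_one (δ : ℕ → ℝ) (G : Set ℕ) :
    bernoulli p (⋂ N : ℕ, ⋃ n ≥ N, ⋃ (_ : n ∈ G), ⋃ l ∈ lookback n, recurSet p (δ n) n l) = 0 ∨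
    bernoulli p (⋂ N : ℕ, ⋃ n ≥ N, ⋃ (_ : n ∈ G), ⋃ l ∈ lookback n, recurSet p (δ n) n l) = 1 := by
  set U : ℕ → Set (ℕ → A) := fun N =>
    ⋃ n ≥ N, ⋃ (_ : n ∈ G), ⋃ l ∈ lookback n, recurSet p (δ n) n l with hU
  have hanti : Antitone U := fun N N' h =>
    biUnion_subset_biUnion_left fun n hn => h.trans hn
  refine ProbabilityTheory.measure_zero_or_one_of_measurableSet_limsup_atTop
    (s := fun i => MeasurableSpace.comap (fun ω : ℕ → A => ω i) inferInstance)
    (fun i => (measurable_pi_apply i).comap_le)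
    (ProbabilityTheory.iIndepFun_infinitePi (P := fun _ : ℕ => IFS.letterMeasure p)
      (X := fun _ a => a) fun _ => measurable_id) ?_
  rw [limsup_eq_iInf_iSup_of_nat, MeasurableSpace.measurableSet_iInf]
  intro N
  -- Recurrences at times `n ≥ 4 * N` look back to positions `l ≥ N` only.
  have h : ⋂ N, U N = ⋂ K, U (4 * N + K) := by
    refine (subset_iInter fun K => iInter_subset _ _).antisymm (subset_iInter fun K => ?_)
    exact (iInter_subset _ K).trans (hanti (by omega))
  rw [h]
  refine MeasurableSet.iInter fun K => MeasurableSet.iUnion fun n => MeasurableSet.iUnion fun hn =>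
    MeasurableSet.iUnion fun _ => MeasurableSet.iUnion fun l => MeasurableSet.iUnion fun hl => ?_
  simp only [lookback, Finset.mem_Ico] at hl
  exact measurableSet_tail_recurSet p _ (by omega) (by omega)

/-- The divergence part of the Borel–Cantelli lemma for recurrences of Bernoulli sequences: if
`∑ n δ_n` diverges, then for almost every sequence the part of `σⁿ ω` cut at weight `δ_n` occurs at
a position before `n`, for infinitely many `n`. -/
theorem ae_frequently_mem_recurSet (hp : ∀ a, 0 < p a) {κ ρ : ℝ} (hκ0 : 0 < κ)
    (hκ : ∀ a, κ ≤ p a) (hκ1 : κ ≤ 1) (hρ : ∀ a, p a ≤ ρ) (hρ0 : 0 < ρ) (hρ1 : ρ < 1)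
    {δ : ℕ → ℝ} (hδ1 : ∀ n, δ n < 1) (hdiv : ∑' n : ℕ, ENNReal.ofReal (n * δ n) = ∞) :
    ∀ᵐ ω ∂(bernoulli p), ∀ N, ∃ n ≥ N, ∃ l < n, ω ∈ recurSet p (δ n) n l := by
  obtain ⟨G, hG, hdom, hGdiv⟩ := exists_undominated_set hρ0 hρ1 (fun n => (hδ1 n).le) hdiv
  obtain ⟨c, hc0, hc⟩ := exists_le_bernoulli_iUnion_recurSet hp hκ0 hκ hκ1 hρ hρ1 hδ1
    (fun n hn => (pow_pos hρ0 _).trans_le (hG n hn)) hG hdom hGdiv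
  set U : ℕ → Set (ℕ → A) := fun N =>
    ⋃ n ≥ N, ⋃ (_ : n ∈ G), ⋃ l ∈ lookback n, recurSet p (δ n) n l with hU
  have hanti : Antitone U := fun N N' h =>
    biUnion_subset_biUnion_left fun n hn => h.trans hn
  have hUm : ∀ N, MeasurableSet (U N) := fun N =>
    MeasurableSet.iUnion fun n => MeasurableSet.iUnion fun _ => MeasurableSet.iUnion fun _ =>
      MeasurableSet.iUnion fun l => MeasurableSet.iUnion fun _ => measurableSet_recurSet p _ _ _
  have hlow : c ≤ bernoulli p (⋂ N, U N) := by
    rw [hanti.measure_iInter (fun N => (hUm N).nullMeasurableSet) ⟨0, measure_ne_top _ _⟩]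
    exact le_iInf hc
  have hone : bernoulli p (⋂ N, U N) = 1 := by
    rcases bernoulli_limsup_recurSet_eq_zero_or_one (p := p) δ G with h | h
    · exact absurd (hlow.trans_eq h) (not_le.2 hc0)
    · exact h
  have hae : ∀ᵐ ω ∂(bernoulli p), ω ∈ ⋂ N, U N :=
    (mem_ae_iff_prob_eq_one (MeasurableSet.iInter hUm)).2 hone
  filter_upwards [hae] with ω hω N
  have hN := mem_iInter.1 hω N
  simp only [hU, mem_iUnion] at hN
  obtain ⟨n, hn, -, l, hl, h⟩ := hN
  simp only [lookback, Finset.mem_Ico] at hl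
  exact ⟨n, hn, l, by omega, h⟩

end SymbolicRecurrence

namespace SymbolicRecurrence

variable {A : Type*} {d : ℕ}

/-! ### From symbolic recurrences to the limsup set -/

lemma dist_wordMap (Φ : IFS A d) (n : ℕ) : ∀ (a : Fin n → A) (x y : EuclideanSpace ℝ (Fin d)),
    dist (Φ.wordMap n a x) (Φ.wordMap n a y) = (∏ i, Φ.ratio (a i)) * dist x y := by
  induction n with
  | zero => intro a x y; simp [IFS.wordMap]
  | succ n ih =>
    intro a x y
    rw [IFS.wordMap, Function.comp_apply, Function.comp_apply, Φ.dist_map, ih, Fin.prod_univ_succ,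
      mul_assoc]

lemma dist_prefixMap (Φ : IFS A d) (ω : ℕ → A) (n : ℕ) (x y : EuclideanSpace ℝ (Fin d)) :
    dist (Φ.prefixMap ω n x) (Φ.prefixMap ω n y) = weight Φ.ratio ω n * dist x y := by
  rw [IFS.prefixMap, dist_wordMap, weight, Finset.prod_range]

lemma proj_eq_prefixMap [Finite A] (Φ : IFS A d) (n : ℕ) : ∀ ω : ℕ → A,
    Φ.proj ω = Φ.prefixMap ω n (Φ.proj (shift n ω)) := by
  induction n with
  | zero =>
    intro ω
    rw [IFS.prefixMap_zero]
    congr 1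
    funext i
    simp [shift]
  | succ n ih =>
    intro ω
    rw [Φ.proj_eq_map, IFS.prefixMap_succ, ih fun i => ω (i + 1)]
    congr 3
    funext i
    simp only [shift]
    congr 1
    omega

lemma isCompact_selfSimilarSet [Finite A] [Nonempty A] (Φ : IFS A d) :
    IsCompact Φ.selfSimilarSet := Φ.selfSimilarSet_spec.2.1

lemma diam_cylinderSet [Finite A] [Nonempty A] (Φ : IFS A d) {n : ℕ} (a : Fin n → A) :
    Metric.diam (Φ.cylinderSet a) = (∏ i, Φ.ratio (a i)) * Metric.diam Φ.selfSimilarSet := by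
  have hpos : 0 < ∏ i, Φ.ratio (a i) := Finset.prod_pos fun i _ => Φ.ratio_pos _
  have hbdd := (isCompact_selfSimilarSet Φ).isBounded
  have hdist : ∀ x ∈ Φ.selfSimilarSet, ∀ y ∈ Φ.selfSimilarSet,
      dist (Φ.wordMap n a x) (Φ.wordMap n a y) ≤
        (∏ i, Φ.ratio (a i)) * Metric.diam Φ.selfSimilarSet := fun x hx y hy => by
    rw [dist_wordMap]
    exact mul_le_mul_of_nonneg_left (Metric.dist_le_diam_of_mem hbdd hx hy) hpos.le
  have hbdd' : Bornology.IsBounded (Φ.cylinderSet a) := by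
    refine Metric.isBounded_iff.2
      ⟨(∏ i, Φ.ratio (a i)) * Metric.diam Φ.selfSimilarSet, ?_⟩
    rintro _ ⟨x, hx, rfl⟩ _ ⟨y, hy, rfl⟩
    exact hdist x hx y hy
  refine le_antisymm (Metric.diam_le_of_forall_dist_le (by positivity) ?_) ?_
  · rintro _ ⟨x, hx, rfl⟩ _ ⟨y, hy, rfl⟩
    exact hdist x hx y hy
  · rw [mul_comm, ← le_div_iff₀ hpos]
    refine Metric.diam_le_of_forall_dist_le (by positivity) fun x hx y hy => ?_
    rw [le_div_iff₀ hpos, mul_comm, ← dist_wordMap]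
    exact Metric.dist_le_diam_of_mem hbdd' (mem_image_of_mem _ hx) (mem_image_of_mem _ hy)

lemma eventuallyPeriodic_eq {ω : ℕ → A} {n k : ℕ} (l : Fin n)
    (h : ∀ i < k, ω (l + i) = ω (n + i)) {i : ℕ} (hi : i < n + k) :
    IFS.eventuallyPeriodic (fun j : Fin n => ω j) l i = ω i := by
  have hl := l.isLt
  by_cases hil : i < l
  · simp [IFS.eventuallyPeriodic, hil]
  · obtain ⟨t, rfl⟩ : ∃ t, i = l + t := ⟨i - l, by omega⟩
    rw [eq_periodize_of_repeat hl h t (by omega)]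
    simp [IFS.eventuallyPeriodic, periodize]

section Weights

variable [Fintype A] [Nonempty A] (Φ : IFS A d)

lemma prob_pos (a : A) : 0 < Φ.prob a := Real.rpow_pos_of_pos (Φ.ratio_pos a) _

lemma weight_prob (x : ℕ → A) (k : ℕ) : weight Φ.prob x k = weight Φ.ratio x k ^ Φ.dimS :=
  Real.finsetProd_rpow _ _ (fun _ _ => (Φ.ratio_pos _).le) _

variable {Φ}

lemma dimS_pos (hA : 2 ≤ Fintype.card A) : 0 < Φ.dimS := by
  by_contra! h
  have h1 : ∑ _a : A, (1 : ℝ) ≤ ∑ a, Φ.ratio a ^ Φ.dimS := Finset.sum_le_sum fun a _ =>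
    Real.one_le_rpow_of_pos_of_le_one_of_nonpos (Φ.ratio_pos a) (Φ.ratio_lt_one a).le h
  rw [Φ.sum_ratio_rpow_dimS, Finset.sum_const, Finset.card_univ, nsmul_eq_mul, mul_one] at h1
  have : (2 : ℝ) ≤ Fintype.card A := by exact_mod_cast hA
  linarith

lemma prob_lt_one (hA : 2 ≤ Fintype.card A) (a : A) : Φ.prob a < 1 :=
  Real.rpow_lt_one (Φ.ratio_pos a).le (Φ.ratio_lt_one a) (dimS_pos hA)

/-- A symbolic recurrence at time `n` forces `π(ω)` to be close to the projection of an eventually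
periodic sequence, on the scale of the cylinder of `ω_0 ⋯ ω_{n-1}`. -/
lemma proj_mem_ball_of_mem_recurSet (hA : 2 ≤ Fintype.card A)
    (hD : 0 < Metric.diam Φ.selfSimilarSet) {ω : ℕ → A} {n : ℕ} (l : Fin n) {δ g : ℝ}
    (hg : 0 ≤ g) (hδ : δ ≤ g ^ Φ.dimS / 2) (h : ω ∈ recurSet Φ.prob δ n l) :
    Φ.proj ω ∈ Metric.ball (Φ.proj (IFS.eventuallyPeriodic (fun i : Fin n => ω i) l))
      (Metric.diam (Φ.cylinderSet fun i : Fin n => ω i) * g) := by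
  obtain ⟨k, hk, hagr⟩ := h
  set η := IFS.eventuallyPeriodic (fun i : Fin n => ω i) l with hη
  have heq : ∀ i < n + k, η i = ω i := fun i hi => eventuallyPeriodic_eq l hagr hi
  have hpre : Φ.prefixMap η (n + k) = Φ.prefixMap ω (n + k) := by
    simp only [IFS.prefixMap]
    congr 1
    funext i
    exact heq i i.isLt
  have hmem : ∀ x : ℕ → A, Φ.proj x ∈ Φ.selfSimilarSet := fun x => by
    rw [Φ.selfSimilarSet_eq_range_proj]
    exact mem_range_self x
  have hw0 := weight_pos Φ.ratio_pos (shift n ω) k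
  have hw : weight Φ.ratio (shift n ω) k < g := by
    rw [← Real.rpow_lt_rpow_iff hw0.le hg (dimS_pos hA), ← weight_prob,
      ← weight_congr hagr]
    have := weight_pos (prob_pos Φ) (shift l ω) k
    linarith
  have hn0 := weight_pos Φ.ratio_pos ω n
  rw [Metric.mem_ball, proj_eq_prefixMap Φ (n + k) ω, proj_eq_prefixMap Φ (n + k) η, hpre,
    dist_prefixMap, weight_add, diam_cylinderSet, ← Finset.prod_range (fun i => Φ.ratio (ω i))]
  calc weight Φ.ratio ω n * weight Φ.ratio (shift n ω) k *
        dist (Φ.proj (shift (n + k) ω)) (Φ.proj (shift (n + k) η))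
      ≤ weight Φ.ratio ω n * weight Φ.ratio (shift n ω) k * Metric.diam Φ.selfSimilarSet :=
        mul_le_mul_of_nonneg_left (Metric.dist_le_diam_of_mem
          (isCompact_selfSimilarSet Φ).isBounded (hmem _) (hmem _)) (by positivity)
    _ < weight Φ.ratio ω n * g * Metric.diam Φ.selfSimilarSet := by gcongr
    _ = weight Φ.ratio ω n * Metric.diam Φ.selfSimilarSet * g := by ring

/-- The series in the theorem is `∑ n (diam X * g n) ^ dimS`, as the weights of the words of a given
length sum to `1`. -/
lemma sum_words_eq (Φ : IFS A d) (g : ℝ≥0) (n : ℕ) :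
    ∑ a : Fin n → A, ENNReal.ofReal (n * (Metric.diam (Φ.cylinderSet a) * g) ^ Φ.dimS) =
      ENNReal.ofReal (n * (Metric.diam Φ.selfSimilarSet * g) ^ Φ.dimS) := by
  have hD : 0 ≤ Metric.diam Φ.selfSimilarSet := Metric.diam_nonneg
  have hterm : ∀ a : Fin n → A, (n : ℝ) * (Metric.diam (Φ.cylinderSet a) * g) ^ Φ.dimS =
      (∏ i, Φ.prob (a i)) * (n * (Metric.diam Φ.selfSimilarSet * g) ^ Φ.dimS) := fun a => by
    have hprod : ∏ i, Φ.prob (a i) = (∏ i, Φ.ratio (a i)) ^ Φ.dimS :=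
      Real.finsetProd_rpow _ _ (fun _ _ => (Φ.ratio_pos _).le) _
    rw [diam_cylinderSet, mul_assoc, Real.mul_rpow
      (Finset.prod_nonneg fun _ _ => (Φ.ratio_pos _).le) (by positivity), hprod]
    ring
  rw [← ENNReal.ofReal_sum_of_nonneg fun a _ => by
    have : 0 ≤ Metric.diam (Φ.cylinderSet a) := Metric.diam_nonneg
    positivity]
  simp only [hterm]
  rw [← Finset.sum_mul, ← Fintype.sum_pow, Φ.sum_prob, one_pow, one_mul]

end Weights

/-- Truncating the terms at `1` does not affect the divergence of `∑ n f(n)`. -/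
lemma tsum_mul_min_eq_top {f : ℕ → ℝ} (hf : ∀ n, 0 ≤ f n)
    (h : ∑' n : ℕ, ENNReal.ofReal (n * f n) = ∞) :
    ∑' n : ℕ, ENNReal.ofReal (n * (min 1 (f n) / 2)) = ∞ := by
  have h0 : ∀ n, 0 ≤ min 1 (f n) / 2 := fun n => div_nonneg (le_min zero_le_one (hf n)) zero_le_two
  by_contra hne
  have hs : Summable fun n : ℕ => (n : ℝ) * (min 1 (f n) / 2) := by
    refine (ENNReal.summable_toReal hne).congr fun n => ?_
    exact ENNReal.toReal_ofReal (mul_nonneg (Nat.cast_nonneg n) (h0 n))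
  have hs2 : Summable fun n : ℕ => (n : ℝ) * f n := by
    refine (hs.mul_left 2).congr_atTop ?_
    filter_upwards [hs.tendsto_atTop_zero.eventually
      (gt_mem_nhds (show (0 : ℝ) < 1 / 2 by norm_num)), eventually_ge_atTop 1] with n hn hn1
    have hn1' : (1 : ℝ) ≤ n := by exact_mod_cast hn1
    have hlt : min 1 (f n) < 1 := by nlinarith [h0 n]
    have : min 1 (f n) = f n := by
      refine min_eq_right ?_
      by_contra! hgt
      rw [min_eq_left hgt.le] at hlt
      exact lt_irrefl _ hlt
    rw [this]
    ring
  exact hs2.tsum_ofReal_ne_top h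

/-- The divergence case, for an alphabet with at least two letters and an arbitrary function `g`. -/
theorem selfSimilarMeasure_limsupSet_eq_one [Fintype A] [Nonempty A] (Φ : IFS A d)
    {Ψ : (n : ℕ) → (Fin n → A) → ℝ≥0} (hA : 2 ≤ Fintype.card A) (g : ℕ → ℝ≥0)
    (hΨ : ∀ n ≥ 1, ∀ a : Fin n → A, (Ψ n a : ℝ) = Metric.diam (Φ.cylinderSet a) * g n)
    (hdiv : ∑' n : ℕ+, ∑ a : Fin n → A,
      ENNReal.ofReal (n * (Metric.diam (Φ.cylinderSet a) * g n) ^ Φ.dimS) = ∞) :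
    Φ.selfSimilarMeasure (Φ.limsupSet Ψ) = 1 := by
  have hs := dimS_pos (Φ := Φ) hA
  simp only [sum_words_eq] at hdiv
  have hD : 0 < Metric.diam Φ.selfSimilarSet := by
    refine lt_of_le_of_ne Metric.diam_nonneg fun h => ?_
    rw [← h] at hdiv
    simp [Real.zero_rpow hs.ne'] at hdiv
  have hdiv' : ∑' n : ℕ, ENNReal.ofReal (n * (g n : ℝ) ^ Φ.dimS) = ∞ := by
    have hle : ∑' n : ℕ+, ENNReal.ofReal (n * (Metric.diam Φ.selfSimilarSet * g n) ^ Φ.dimS) ≤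
        ENNReal.ofReal (Metric.diam Φ.selfSimilarSet ^ Φ.dimS) *
          ∑' n : ℕ, ENNReal.ofReal (n * (g n : ℝ) ^ Φ.dimS) := by
      rw [← ENNReal.tsum_mul_left]
      refine le_trans (le_of_eq (tsum_congr fun n => ?_)) (ENNReal.tsum_comp_le_tsum_of_injective
        PNat.coe_injective _)
      rw [← ENNReal.ofReal_mul (by positivity), Real.mul_rpow hD.le (g n).coe_nonneg]
      congr 1
      ring
    rw [hdiv, top_le_iff] at hle
    by_contra hne
    exact ENNReal.mul_ne_top ENNReal.ofReal_ne_top hne hle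
  -- The factor `1 / 2` turns the non-strict bound on weights into the strict one for open balls.
  set δ : ℕ → ℝ := fun n => min 1 ((g n : ℝ) ^ Φ.dimS) / 2 with hδ
  have hδ1 : ∀ n, δ n < 1 := fun n => by
    have := min_le_left 1 ((g n : ℝ) ^ Φ.dimS)
    simp only [hδ]
    linarith
  have hδdiv : ∑' n : ℕ, ENNReal.ofReal (n * δ n) = ∞ :=
    tsum_mul_min_eq_top (fun n => Real.rpow_nonneg (g n).coe_nonneg _) hdiv'
  obtain ⟨a₀, ha₀⟩ := Finite.exists_min Φ.prob
  obtain ⟨a₁, ha₁⟩ := Finite.exists_max Φ.prob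
  let _ : MeasurableSpace A := ⊤
  have hprob := IFS.isProbabilityMeasure_letterMeasure Φ.prob_nonneg Φ.sum_prob
  have hae := ae_frequently_mem_recurSet (prob_pos Φ) (prob_pos Φ a₀) ha₀ (prob_lt_one hA a₀).le
    ha₁ (prob_pos Φ a₁) (prob_lt_one hA a₁) hδ1 hδdiv
  have hμ := Φ.selfSimilarMeasure_spec
  have hμ1 := hμ.1
  refine le_antisymm prob_le_one ?_
  rw [hμ.eq_map_proj]
  refine le_trans ?_ (Measure.le_map_apply Φ.measurable_proj.aemeasurable _)
  have hae' : ∀ᵐ ω ∂(bernoulli Φ.prob), ω ∈ Φ.proj ⁻¹' Φ.limsupSet Ψ := by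
    filter_upwards [hae] with ω hω
    simp only [mem_preimage, IFS.limsupSet, mem_iInter, mem_iUnion]
    intro N hN
    obtain ⟨n, hn, l, hl, h⟩ := hω N
    refine ⟨n, hn, fun i => ω i, ⟨l, hl⟩, ?_⟩
    rw [hΨ n (hN.trans hn)]
    refine proj_mem_ball_of_mem_recurSet hA hD ⟨l, hl⟩ (g n).coe_nonneg ?_ h
    exact div_le_div_of_nonneg_right (min_le_right _ _) zero_le_two
  rw [← measure_univ (μ := bernoulli Φ.prob)]
  exact measure_mono_ae (hae'.mono fun ω hω _ => hω)

lemma two_le_card_of_entropy_lt [Fintype A] [Nonempty A] (Φ : IFS A d)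
    (h : entropy Φ.prob < -2 * Real.log (∑ a, Φ.prob a ^ 2)) : 2 ≤ Fintype.card A := by
  by_contra! hlt
  have : Subsingleton A := Fintype.card_le_one_iff_subsingleton.1 (by omega)
  obtain ⟨a⟩ := ‹Nonempty A›
  have hp : Φ.prob a = 1 := by
    have hsum := Φ.sum_prob
    rwa [Fintype.sum_subsingleton _ a] at hsum
  rw [entropy, Fintype.sum_subsingleton _ a, Fintype.sum_subsingleton _ a, hp] at h
  norm_num at h

/-! ### The convergence case -/

lemma hausdorffMeasure_limsupSet_eq_zero [Fintype A] (Φ : IFS A d)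
    (Ψ : (n : ℕ) → (Fin n → A) → ℝ≥0) {s : ℝ} (hs : 0 < s)
    (h : ∑' n : ℕ+, ∑ a : Fin n → A, ENNReal.ofReal (n * (Ψ n a : ℝ) ^ s) < ∞) :
    μH[s] (Φ.limsupSet Ψ) = 0 := by
  set u : ℕ → ℝ≥0∞ := fun n => ∑ a : Fin n → A, ENNReal.ofReal (n * (Ψ n a : ℝ) ^ s) with hu
  have hterm : ∀ n (a : Fin n → A), ENNReal.ofReal (n * (Ψ n a : ℝ) ^ s) =
      n * (Ψ n a : ℝ≥0∞) ^ s := fun n a => by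
    rw [ENNReal.ofReal_mul (Nat.cast_nonneg n), ENNReal.ofReal_natCast,
      ← ENNReal.ofReal_rpow_of_nonneg (Ψ n a).coe_nonneg hs.le, ENNReal.ofReal_coe_nnreal]
  have hsum : ∑' n, u (n + 1) ≠ ∞ := by
    rw [← tsum_pnat_eq_tsum_succ]
    exact h.ne
  set tail : ℕ → ℝ≥0∞ := fun N => ∑' k, u (k + N + 1) with htail
  have htail0 : Tendsto tail atTop (𝓝 0) := ENNReal.tendsto_sum_nat_add _ hsum
  have hball : ∀ n (a : Fin n → A) (l : Fin n),
      Metric.ediam (Metric.ball (Φ.proj (IFS.eventuallyPeriodic a l)) (Ψ n a)) ≤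
        2 * (Ψ n a : ℝ≥0∞) := fun n a l => by
    rw [← Metric.eball_coe]
    exact Metric.ediam_eball_le
  let ι : ℕ → Type _ := fun N => Σ k : ℕ, (Fin (k + N + 1) → A) × Fin (k + N + 1)
  let t : (N : ℕ) → ι N → Set (EuclideanSpace ℝ (Fin d)) := fun N i =>
    Metric.ball (Φ.proj (IFS.eventuallyPeriodic i.2.1 i.2.2)) (Ψ (i.1 + N + 1) i.2.1)
  have hle : μH[s] (Φ.limsupSet Ψ) ≤
      liminf (fun N => ∑' i : ι N, Metric.ediam (t N i) ^ s) atTop := by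
    refine Measure.hausdorffMeasure_le_liminf_tsum s _ (fun N => 2 * tail N ^ s⁻¹) ?_ t ?_ ?_
    · have h1 : Tendsto (fun N => tail N ^ s⁻¹) atTop (𝓝 (0 ^ s⁻¹)) :=
        (ENNReal.continuous_rpow_const.tendsto 0).comp htail0
      rw [ENNReal.zero_rpow_of_pos (inv_pos.2 hs)] at h1
      simpa using ENNReal.Tendsto.const_mul h1 (Or.inr (by norm_num : (2 : ℝ≥0∞) ≠ ∞))
    · refine Eventually.of_forall fun N => ?_
      rintro ⟨k, a, l⟩
      refine (hball _ a l).trans (mul_le_mul_right ?_ _)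
      rw [ENNReal.le_rpow_inv_iff hs]
      calc (Ψ (k + N + 1) a : ℝ≥0∞) ^ s
          ≤ ((k + N + 1 : ℕ) : ℝ≥0∞) * (Ψ (k + N + 1) a : ℝ≥0∞) ^ s := by
            refine le_mul_of_one_le_left zero_le ?_
            exact_mod_cast (by omega : 1 ≤ k + N + 1)
        _ ≤ u (k + N + 1) := by
            rw [← hterm]
            exact Finset.single_le_sum (f := fun a => ENNReal.ofReal (((k + N + 1 : ℕ) : ℝ) *
              (Ψ (k + N + 1) a : ℝ) ^ s)) (fun _ _ => zero_le) (Finset.mem_univ a)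
        _ ≤ tail N := ENNReal.le_tsum (f := fun k => u (k + N + 1)) k
    · refine Eventually.of_forall fun N x hx => ?_
      simp only [IFS.limsupSet, mem_iInter, mem_iUnion] at hx
      obtain ⟨n, hn, a, l, hx⟩ := hx (N + 1) (by omega)
      obtain ⟨k, rfl⟩ : ∃ k, n = k + N + 1 := ⟨n - (N + 1), by omega⟩
      exact mem_iUnion.2 ⟨⟨k, a, l⟩, hx⟩
  have hbound : ∀ N, ∑' i : ι N, Metric.ediam (t N i) ^ s ≤ 2 ^ s * tail N := by
    intro N
    rw [ENNReal.tsum_sigma', htail, ← ENNReal.tsum_mul_left]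
    refine ENNReal.tsum_le_tsum fun k => ?_
    rw [tsum_fintype, Fintype.sum_prod_type, hu, Finset.mul_sum]
    refine Finset.sum_le_sum fun a _ => ?_
    calc ∑ l : Fin (k + N + 1), Metric.ediam (t N ⟨k, a, l⟩) ^ s
        ≤ ∑ _l : Fin (k + N + 1), (2 * (Ψ (k + N + 1) a : ℝ≥0∞)) ^ s :=
          Finset.sum_le_sum fun l _ => ENNReal.rpow_le_rpow (hball _ a l) hs.le
      _ = 2 ^ s * ENNReal.ofReal ((k + N + 1 : ℕ) * (Ψ (k + N + 1) a : ℝ) ^ s) := by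
          rw [hterm, Finset.sum_const, Finset.card_univ, Fintype.card_fin, nsmul_eq_mul,
            ENNReal.mul_rpow_of_nonneg _ _ hs.le]
          ring
  have hlim : Tendsto (fun N => 2 ^ s * tail N) atTop (𝓝 0) := by
    simpa using ENNReal.Tendsto.const_mul htail0
      (Or.inr (ENNReal.rpow_ne_top_of_nonneg hs.le (by norm_num : (2 : ℝ≥0∞) ≠ ∞)))
  refine le_antisymm (hle.trans ?_) zero_le
  have h0 := tendsto_of_tendsto_of_tendsto_of_le_of_le tendsto_const_nhds hlim
    (fun _ => zero_le) hbound
  exact h0.liminf_eq.le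

end SymbolicRecurrence

open SymbolicRecurrence

theorem theorem1p1 {A : Type*} [Fintype A] [Nonempty A] {d : ℕ} (Φ : IFS A d)
    (Ψ : (n : ℕ) → (Fin n → A) → ℝ≥0) :
    -- (1)
    (∀ s : ℝ, 0 ≤ s →
      ∑' n : ℕ+, ∑ a : Fin n → A, ENNReal.ofReal (n * (Ψ n a : ℝ) ^ s) < ∞ →
      μH[s] (Φ.limsupSet Ψ) = 0) ∧
    -- (2)
    (entropy Φ.prob < -2 * Real.log (∑ a, Φ.prob a ^ 2) →
      ∀ g : ℕ → ℝ≥0, AntitoneOn g (Ici 1) →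
      (∀ n ≥ 1, ∀ a : Fin n → A, (Ψ n a : ℝ) = Metric.diam (Φ.cylinderSet a) * g n) →
      ∑' n : ℕ+, ∑ a : Fin n → A,
        ENNReal.ofReal (n * (Metric.diam (Φ.cylinderSet a) * g n) ^ Φ.dimS) = ∞ →
      Φ.selfSimilarMeasure (Φ.limsupSet Ψ) = 1) ∧
    -- (3)
    (2 ≤ Fintype.card A → (∀ a b, Φ.ratio a = Φ.ratio b) →
      ∀ g : ℕ → ℝ≥0,
      (∀ n ≥ 1, ∀ a : Fin n → A, (Ψ n a : ℝ) = Metric.diam (Φ.cylinderSet a) * g n) →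
      ∑' n : ℕ+, ∑ a : Fin n → A,
        ENNReal.ofReal (n * (Metric.diam (Φ.cylinderSet a) * g n) ^ Φ.dimS) = ∞ →
      Φ.selfSimilarMeasure (Φ.limsupSet Ψ) = 1) := by
  refine ⟨fun s hs h => ?_, fun hent g _ hΨ hdiv => ?_, fun hA _ g hΨ hdiv => ?_⟩
  · rcases hs.eq_or_lt with rfl | hs
    · -- Every term of the series is at least `1`, so it cannot converge.
      refine absurd h (not_lt.2 ?_)
      rw [← ENNReal.tsum_const_eq_top_of_ne_zero (α := ℕ+) one_ne_zero]
      refine ENNReal.tsum_le_tsum fun n => ?_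
      refine le_trans ?_ (Finset.single_le_sum (fun _ _ => zero_le)
        (Finset.mem_univ fun _ => Classical.arbitrary A))
      rw [Real.rpow_zero, mul_one, ENNReal.one_le_ofReal]
      exact_mod_cast n.pos
    · exact hausdorffMeasure_limsupSet_eq_zero Φ Ψ hs h
  · exact selfSimilarMeasure_limsupSet_eq_one Φ (two_le_card_of_entropy_lt Φ hent) g hΨ hdiv
  · exact selfSimilarMeasure_limsupSet_eq_one Φ hA g hΨ hdiv
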